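/- Let $\mathrm{M}$ be a loopless matroid on a finite set $E$, and let $\mathscr{P}(\mathrm{M})$ be the poset of nonempty proper flats of $\mathrm{M}$, ordered by inclusion. For an order filter (upward closed subset) $\mathscr{P}\subseteq\mathscr{P}(\mathrm{M})$, let $A^*(\mathrm{M},\mathscr{P})$ be the graded ring obtained as the quotient of the polynomial ring $\mathbb{Z}[x_i,x_F]_{i\in E,\,F\in\mathscr{P}}$ (all variables of degree one) by the ideal generated by (1) $x_{F_1}x_{F_2}$, for incomparable $F_1,F_2\in\mathscr{P}$; (2) $x_i x_F$, for $F\in\mathscr{P}$ and $i\in E\setminus F$; (3) $\prod_{i\in I}x_i$, for independent sets $I$ of $\mathrm{M}$ whose closure is in $\mathscr{P}\cup\{E\}$; (4) $\big(x_i+\sum_{i\in F\in\mathscr{P}}x_F\big)-\big(x_j+\sum_{j\in F\in\mathscr{P}}x_F\big)$, for distinct $i,j\in E$. Write $A^k(\mathrm{M},\mathscr{P})$ for its degree $k$ component (zero for $k<0$), and $A^*(\mathrm{M}):=A^*(\mathrm{M},\mathscr{P}(\mathrm{M}))$. Let $\mathscr{P}_-\subseteq\mathscr{P}(\mathrm{M})$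 be an order filter, let $Z$ be a maximal element of $\mathscr{P}(\mathrm{M})\setminus\mathscr{P}_-$, and set $\mathscr{P}_+:=\mathscr{P}_-\cup\{Z\}$, which is again an order filter. Let $\mathrm{M}_Z$ be the contraction of $\mathrm{M}$ by $Z$, a loopless matroid on $E\setminus Z$; its nonempty proper flats are identified with the proper flats of $\mathrm{M}$ strictly containing $Z$ by $G\mapsto G\cup Z$. Let $$\Phi_Z^q:A^q(\mathrm{M},\mathscr{P}_-)\longrightarrow A^q(\mathrm{M},\mathscr{P}_+)$$ be the degree $q$ part of the graded ring homomorphism determined by $x_F\mapsto x_F$ for $F\in\mathscr{P}_-$, $x_i\mapsto x_i+x_Z$ for $i\in Z$, and $x_i\mapsto x_i$ for $i\in E\setminus Z$. For $p\ge 1$, let $$\Psi_Z^{p,q}:A^{q-p}(\mathrm{M}_Z)\longrightarrow A^q(\mathrm{M},\mathscr{P}_+)$$ be the group homomorphism determined by $x_{\mathscr{F}}\mapsto x_Z^p\,x_{\mathscr{F}}$, where $x_{\mathscr{F}}=\prod_{F\in\mathscr{F}}x_F$ for a flag $\mathscr{F}$ of nonempty proper flats of $\mathrm{M}_Z$. (These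 homomorphisms are well defined.) Then, for every positive integer $q$, the sum of the pullback homomorphism and the Gysin homomorphisms $$\Phi_Z^q\oplus\bigoplus_{p=1}^{\mathrm{rk}(Z)-1}\Psi_Z^{p,q}\;:\;A^q(\mathrm{M},\mathscr{P}_-)\oplus\bigoplus_{p=1}^{\mathrm{rk}(Z)-1}A^{q-p}(\mathrm{M}_Z)\longrightarrow A^q(\mathrm{M},\mathscr{P}_+)$$ is an isomorphism of abelian groups. -/

import Mathlib

open scoped DirectSum Matroid

namespace MatroidChow

variable {α : Type*}

/-! ### Flats, order filters and matroidal flips -/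

/-- The poset `𝒫(M)` of nonempty proper flats of `M`. -/
def properFlats (M : Matroid α) : Set (Set α) :=
  {F | M.IsFlat F ∧ F.Nonempty ∧ F ≠ M.E}

/-- `P` is an order filter of `𝒫(M)`. -/
structure IsOrderFilter (M : Matroid α) (P : Set (Set α)) : Prop where
  subset_properFlats : P ⊆ properFlats M
  mem_of_subset : ∀ F ∈ P, ∀ G ∈ properFlats M, F ⊆ G → G ∈ P

/-- `Pm` is an order filter of `𝒫(M)` and `Z` is a flat maximal in `𝒫(M) \ Pm`; that is, `Z` is
the center of the matroidal flip from `Pm` to `Pm ∪ {Z}`. -/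
structure IsMatroidalFlip (M : Matroid α) (Pm : Set (Set α)) (Z : Set α) : Prop where
  isOrderFilter : IsOrderFilter M Pm
  maximal : Maximal (fun F => F ∈ properFlats M \ Pm) Z

/-! ### The Chow ring of `(M, P)` -/

/-- The polynomial ring `ℤ[x_i, x_F]` with `i ∈ E` and `F ∈ P`. -/
abbrev PolyRing (M : Matroid α) (P : Set (Set α)) : Type _ := MvPolynomial (M.E ⊕ P) ℤ

/-- The variable `x_i`, for an element `i` of the ground set. -/
noncomputable def eltVar (M : Matroid α) (P : Set (Set α)) (i : M.E) : PolyRing M P :=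
  MvPolynomial.X (Sum.inl i)

/-- The variable `x_F`, for a flat `F` in `P`. -/
noncomputable def flatVar (M : Matroid α) (P : Set (Set α)) (F : P) : PolyRing M P :=
  MvPolynomial.X (Sum.inr F)

/-- The linear form `x_i + ∑_{i ∈ F ∈ P} x_F` (a finite sum when `M` is finite). -/
noncomputable def linForm (M : Matroid α) (P : Set (Set α)) (i : M.E) : PolyRing M P :=
  eltVar M P i + ∑ᶠ F ∈ {F : P | (i : α) ∈ (F : Set α)}, flatVar M P F

/-- Incomparability relations. -/
def incomparabilityRel (M : Matroid α) (P : Set (Set α)) : Set (PolyRing M P) :=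
  {f | ∃ F G : P, ¬ (F : Set α) ⊆ G ∧ ¬ (G : Set α) ⊆ F ∧ f = flatVar M P F * flatVar M P G}

/-- Complement relations. -/
def complementRel (M : Matroid α) (P : Set (Set α)) : Set (PolyRing M P) :=
  {f | ∃ (i : M.E) (F : P), (i : α) ∉ (F : Set α) ∧ f = eltVar M P i * flatVar M P F}

/-- Closure relations. -/
def closureRel (M : Matroid α) (P : Set (Set α)) : Set (PolyRing M P) :=
  {f | ∃ I : Finset M.E, M.Indep (Subtype.val '' (I : Set M.E)) ∧
    M.closure (Subtype.val '' (I : Set M.E)) ∈ P ∪ {M.E} ∧ f = ∏ i ∈ I, eltVar M P i}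

/-- Linear relations. -/
def linearRel (M : Matroid α) (P : Set (Set α)) : Set (PolyRing M P) :=
  {f | ∃ i j : M.E, i ≠ j ∧ f = linForm M P i - linForm M P j}

/-- The ideal of relations of the Chow ring of `(M, P)`. -/
noncomputable def chowIdeal (M : Matroid α) (P : Set (Set α)) : Ideal (PolyRing M P) :=
  Ideal.span (incomparabilityRel M P) ⊔ Ideal.span (complementRel M P) ⊔
    Ideal.span (closureRel M P) ⊔ Ideal.span (linearRel M P)

/-- The Chow ring `A^*(M, P)`. -/
abbrev ChowRing (M : Matroid α) (P : Set (Set α)) : Type _ := PolyRing M P ⧸ chowIdeal M P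

/-- The quotient map onto the Chow ring. -/
noncomputable abbrev toChow (M : Matroid α) (P : Set (Set α)) :
    PolyRing M P →ₐ[ℤ] ChowRing M P :=
  Ideal.Quotient.mkₐ ℤ (chowIdeal M P)

/-- The degree `k` component `A^k(M, P)`, for an integer `k`: the classes of homogeneous
polynomials of degree `k` (every variable has degree one), and zero when `k` is negative. -/
noncomputable def chowDeg (M : Matroid α) (P : Set (Set α)) (k : ℤ) :
    Submodule ℤ (ChowRing M P) :=
  if 0 ≤ k then
    (MvPolynomial.homogeneousSubmodule (M.E ⊕ P) ℤ k.toNat).map (toChow M P).toLinearMap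
  else ⊥

/-! ### Basic facts about the relations -/

theorem toChow_eq_zero_iff {M : Matroid α} {P : Set (Set α)} {f : PolyRing M P} :
    toChow M P f = 0 ↔ f ∈ chowIdeal M P := by
  simp [toChow, Ideal.Quotient.eq_zero_iff_mem]

theorem chowIdeal_le {M : Matroid α} {P : Set (Set α)} {J : Ideal (PolyRing M P)}
    (h1 : incomparabilityRel M P ⊆ J) (h2 : complementRel M P ⊆ J)
    (h3 : closureRel M P ⊆ J) (h4 : linearRel M P ⊆ J) : chowIdeal M P ≤ J :=
  sup_le (sup_le (sup_le (Ideal.span_le.2 h1) (Ideal.span_le.2 h2)) (Ideal.span_le.2 h3))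
    (Ideal.span_le.2 h4)

theorem flatVar_mul_flatVar {M : Matroid α} {P : Set (Set α)} {F G : P}
    (h : ¬ (F : Set α) ⊆ G) (h' : ¬ (G : Set α) ⊆ F) :
    toChow M P (flatVar M P F) * toChow M P (flatVar M P G) = 0 := by
  rw [← map_mul, toChow_eq_zero_iff]
  exact Ideal.mem_sup_left (Ideal.mem_sup_left (Ideal.mem_sup_left
    (Ideal.subset_span ⟨F, G, h, h', rfl⟩)))

theorem eltVar_mul_flatVar {M : Matroid α} {P : Set (Set α)} {i : M.E} {F : P}
    (h : (i : α) ∉ (F : Set α)) :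
    toChow M P (eltVar M P i) * toChow M P (flatVar M P F) = 0 := by
  rw [← map_mul, toChow_eq_zero_iff]
  exact Ideal.mem_sup_left (Ideal.mem_sup_left (Ideal.mem_sup_right
    (Ideal.subset_span ⟨i, F, h, rfl⟩)))

theorem prod_eltVar {M : Matroid α} {P : Set (Set α)} {I : Finset M.E}
    (hI : M.Indep (Subtype.val '' (I : Set M.E)))
    (h : M.closure (Subtype.val '' (I : Set M.E)) ∈ P ∪ {M.E}) :
    ∏ i ∈ I, toChow M P (eltVar M P i) = 0 := by
  rw [← map_prod, toChow_eq_zero_iff]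
  exact Ideal.mem_sup_left (Ideal.mem_sup_right (Ideal.subset_span ⟨I, hI, h, rfl⟩))

theorem toChow_linForm (M : Matroid α) (P : Set (Set α)) (i j : M.E) :
    toChow M P (linForm M P i) = toChow M P (linForm M P j) := by
  by_cases hij : i = j
  · rw [hij]
  rw [← sub_eq_zero, ← map_sub, toChow_eq_zero_iff]
  exact Ideal.mem_sup_right (Ideal.subset_span ⟨i, j, hij, rfl⟩)

theorem finite_properFlats (M : Matroid α) [M.Finite] : (properFlats M).Finite :=
  M.ground_finite.finite_subsets.subset fun _ hF => hF.1.subset_ground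

theorem IsOrderFilter.finite {M : Matroid α} [M.Finite] {P : Set (Set α)}
    (hP : IsOrderFilter M P) : Finite P :=
  ((finite_properFlats M).subset hP.subset_properFlats).to_subtype

namespace IsMatroidalFlip

variable {M : Matroid α} {Pm : Set (Set α)} {Z : Set α}

theorem isFlat (h : IsMatroidalFlip M Pm Z) : M.IsFlat Z := h.maximal.prop.1.1

theorem ne_ground (h : IsMatroidalFlip M Pm Z) : Z ≠ M.E := h.maximal.prop.1.2.2

theorem notMem (h : IsMatroidalFlip M Pm Z) : Z ∉ Pm := h.maximal.prop.2

/-- The center is minimal in `Pm ∪ {Z}`. -/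
theorem not_subset (h : IsMatroidalFlip M Pm Z) {F : Set α} (hF : F ∈ Pm) : ¬ F ⊆ Z :=
  fun hFZ => h.notMem (h.isOrderFilter.mem_of_subset F hF Z h.maximal.prop.1 hFZ)

theorem mem_of_ssubset (h : IsMatroidalFlip M Pm Z) {F : Set α} (hF : F ∈ properFlats M)
    (hZF : Z ⊂ F) : F ∈ Pm := by
  by_contra hF'
  exact hZF.2 (h.maximal.le_of_ge ⟨hF, hF'⟩ hZF.1)

/-- The order filter `P₊ = P₋ ∪ {Z}` is again an order filter. -/
theorem isOrderFilter_plus (h : IsMatroidalFlip M Pm Z) : IsOrderFilter M (Pm ∪ {Z}) where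
  subset_properFlats := by
    rintro F (hF | rfl)
    · exact h.isOrderFilter.subset_properFlats hF
    · exact h.maximal.prop.1
  mem_of_subset := by
    rintro F (hF | rfl) G hG hFG
    · exact Or.inl (h.isOrderFilter.mem_of_subset F hF G hG hFG)
    · rcases eq_or_ne F G with rfl | hne
      · exact Or.inr rfl
      · exact Or.inl (h.mem_of_ssubset hG (hFG.ssubset_of_ne hne))

/-- Proper flats of the contraction `M ／ Z` are identified with flats of `M` strictly between
`Z` and the ground set by `G ↦ G ∪ Z`. -/
theorem mem_properFlats_contract (h : IsMatroidalFlip M Pm Z) {G : Set α} :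
    G ∈ properFlats (M ／ Z) ↔ Disjoint G Z ∧ G.Nonempty ∧ G ∪ Z ∈ properFlats M := by
  have hZE : Z ⊆ M.E := h.isFlat.subset_ground
  have hZne : Z.Nonempty := h.maximal.prop.1.2.1
  simp only [properFlats, Set.mem_ofPred_eq, Matroid.isFlat_iff_closure_eq,
    Matroid.contract_closure_eq, Matroid.contract_ground]
  constructor
  · rintro ⟨h1, h2, h3⟩
    have hd : Disjoint G Z := by
      rw [← h1]
      exact Set.disjoint_sdiff_left
    have hcl : M.closure (G ∪ Z) = G ∪ Z := by
      have hsub : Z ⊆ M.closure (G ∪ Z) := by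
        calc Z = M.closure Z := h.isFlat.closure.symm
          _ ⊆ _ := M.closure_subset_closure Set.subset_union_right
      conv_rhs => rw [← h1]
      exact (Set.sdiff_union_of_subset hsub).symm
    refine ⟨hd, h2, hcl, h2.mono Set.subset_union_left, fun hE => h3 ?_⟩
    rw [← hE, Set.union_sdiff_right, hd.sdiff_eq_left]
  · rintro ⟨hd, h2, hcl, -, hE⟩
    refine ⟨?_, h2, fun hG => hE ?_⟩
    · rw [hcl, Set.union_sdiff_right, hd.sdiff_eq_left]
    · rw [hG, Set.sdiff_union_of_subset hZE]

theorem union_mem (h : IsMatroidalFlip M Pm Z) {G : Set α} (hG : G ∈ properFlats (M ／ Z)) :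
    G ∪ Z ∈ Pm := by
  obtain ⟨hd, hne, hp⟩ := h.mem_properFlats_contract.1 hG
  refine h.mem_of_ssubset hp ⟨Set.subset_union_right, fun hs => ?_⟩
  obtain ⟨x, hx⟩ := hne
  exact Set.disjoint_left.1 hd hx (hs (Or.inl hx))

end IsMatroidalFlip

/-! ### The pullback homomorphism -/

section Pullback

variable {M : Matroid α} {Pm : Set (Set α)} {Z : Set α}

/-- A flat of `Pm` seen as a flat of `Pm ∪ {Z}`. -/
def inclFlat (Pm : Set (Set α)) (Z : Set α) (F : Pm) : (Pm ∪ {Z} : Set (Set α)) :=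
  ⟨F, Or.inl F.2⟩

/-- The center seen as a flat of `Pm ∪ {Z}`. -/
def centerFlat (Pm : Set (Set α)) (Z : Set α) : (Pm ∪ {Z} : Set (Set α)) :=
  ⟨Z, Or.inr rfl⟩

open Classical in
/-- The homomorphism of polynomial rings `x_F ↦ x_F`, `x_i ↦ x_i + x_Z` for `i ∈ Z`, and
`x_i ↦ x_i` for `i ∉ Z`. -/
noncomputable def pullbackPoly (M : Matroid α) (Pm : Set (Set α)) (Z : Set α) :
    PolyRing M Pm →ₐ[ℤ] PolyRing M (Pm ∪ {Z}) :=
  MvPolynomial.aeval (Sum.elim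
    (fun i => if (i : α) ∈ Z then
        eltVar M (Pm ∪ {Z}) i + flatVar M (Pm ∪ {Z}) (centerFlat Pm Z)
      else eltVar M (Pm ∪ {Z}) i)
    (fun F => flatVar M (Pm ∪ {Z}) (inclFlat Pm Z F)))

open Classical in
theorem pullbackPoly_eltVar (i : M.E) :
    pullbackPoly M Pm Z (eltVar M Pm i) = if (i : α) ∈ Z then
        eltVar M (Pm ∪ {Z}) i + flatVar M (Pm ∪ {Z}) (centerFlat Pm Z)
      else eltVar M (Pm ∪ {Z}) i := by
  simp [pullbackPoly, eltVar]

theorem pullbackPoly_flatVar (F : Pm) :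
    pullbackPoly M Pm Z (flatVar M Pm F) = flatVar M (Pm ∪ {Z}) (inclFlat Pm Z F) := by
  simp [pullbackPoly, flatVar]

theorem pullbackPoly_linForm [M.Finite] (h : IsMatroidalFlip M Pm Z) (i : M.E) :
    pullbackPoly M Pm Z (linForm M Pm i) = linForm M (Pm ∪ {Z}) i := by
  classical
  have : Finite Pm := h.isOrderFilter.finite
  have : Finite (Pm ∪ {Z} : Set (Set α)) := h.isOrderFilter_plus.finite
  have hinj : Function.Injective (inclFlat Pm Z) := fun F G hFG => by
    simpa [inclFlat, Subtype.ext_iff] using hFG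
  have hmap : pullbackPoly M Pm Z (∑ᶠ F ∈ {F : Pm | (i : α) ∈ (F : Set α)}, flatVar M Pm F) =
      ∑ᶠ F ∈ inclFlat Pm Z '' {F : Pm | (i : α) ∈ (F : Set α)}, flatVar M (Pm ∪ {Z}) F := by
    rw [finsum_mem_image hinj.injOn]
    simp only [← pullbackPoly_flatVar]
    exact AddMonoidHom.map_finsum_mem _ (pullbackPoly M Pm Z).toLinearMap.toAddMonoidHom
      (Set.toFinite _)
  rw [linForm, linForm, map_add, hmap, pullbackPoly_eltVar]
  split_ifs with hi
  · have hset : {F : (Pm ∪ {Z} : Set (Set α)) | (i : α) ∈ (F : Set α)} =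
        insert (centerFlat Pm Z) (inclFlat Pm Z '' {F : Pm | (i : α) ∈ (F : Set α)}) := by
      ext F
      constructor
      · intro hiF
        rcases F with ⟨F, hF | hF⟩
        · exact Or.inr ⟨⟨F, hF⟩, hiF, rfl⟩
        · exact Or.inl (Subtype.ext hF)
      · rintro (rfl | ⟨G, hG, rfl⟩)
        · exact hi
        · exact hG
    have hnot : centerFlat Pm Z ∉ inclFlat Pm Z '' {F : Pm | (i : α) ∈ (F : Set α)} := by
      rintro ⟨F, -, hF⟩
      have : (F : Set α) = Z := congrArg Subtype.val hF
      exact h.notMem (this ▸ F.2)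
    rw [hset, finsum_mem_insert _ hnot (Set.toFinite _), add_assoc]
  · have hset : {F : (Pm ∪ {Z} : Set (Set α)) | (i : α) ∈ (F : Set α)} =
        inclFlat Pm Z '' {F : Pm | (i : α) ∈ (F : Set α)} := by
      ext F
      constructor
      · intro hiF
        rcases F with ⟨F, hF | hF⟩
        · exact ⟨⟨F, hF⟩, hiF, rfl⟩
        · rw [Set.mem_singleton_iff] at hF
          exact absurd (hF ▸ hiF) hi
      · rintro ⟨G, hG, rfl⟩
        exact hG
    rw [hset]

theorem chowIdeal_le_comap_pullbackPoly [M.Finite] (h : IsMatroidalFlip M Pm Z) :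
    chowIdeal M Pm ≤ (chowIdeal M (Pm ∪ {Z})).comap (pullbackPoly M Pm Z) := by
  classical
  refine chowIdeal_le ?_ ?_ ?_ ?_
  · rintro f ⟨F, G, hFG, hGF, rfl⟩
    rw [SetLike.mem_coe, Ideal.mem_comap, ← toChow_eq_zero_iff, map_mul, map_mul,
      pullbackPoly_flatVar, pullbackPoly_flatVar]
    exact flatVar_mul_flatVar hFG hGF
  · rintro f ⟨i, F, hiF, rfl⟩
    rw [SetLike.mem_coe, Ideal.mem_comap, ← toChow_eq_zero_iff, map_mul, map_mul,
      pullbackPoly_flatVar, pullbackPoly_eltVar]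
    split_ifs with hi
    · rw [map_add, add_mul, eltVar_mul_flatVar (F := inclFlat Pm Z F) hiF, zero_add]
      exact flatVar_mul_flatVar (fun hs => hiF (hs hi)) (h.not_subset F.2)
    · exact eltVar_mul_flatVar (F := inclFlat Pm Z F) hiF
  · rintro f ⟨I, hI, hcl, rfl⟩
    rw [SetLike.mem_coe, Ideal.mem_comap, ← toChow_eq_zero_iff, map_prod, map_prod]
    obtain ⟨i₀, hi₀, hi₀Z⟩ : ∃ i ∈ I, (i : α) ∉ Z := by
      by_contra! hcon
      have hsub : M.closure (Subtype.val '' (I : Set M.E)) ⊆ Z := by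
        rw [← h.isFlat.closure]
        refine M.closure_subset_closure ?_
        rintro _ ⟨i, hi, rfl⟩
        exact hcon i hi
      rcases hcl with hcl | hcl
      · exact h.not_subset hcl hsub
      · rw [Set.mem_singleton_iff] at hcl
        exact h.ne_ground (h.isFlat.subset_ground.antisymm (hcl ▸ hsub))
    have key : ∀ J : Finset M.E,
        toChow M (Pm ∪ {Z}) (eltVar M (Pm ∪ {Z}) i₀) *
          ∏ i ∈ J, toChow M (Pm ∪ {Z}) (pullbackPoly M Pm Z (eltVar M Pm i)) =
        toChow M (Pm ∪ {Z}) (eltVar M (Pm ∪ {Z}) i₀) *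
          ∏ i ∈ J, toChow M (Pm ∪ {Z}) (eltVar M (Pm ∪ {Z}) i) := by
      intro J
      induction J using Finset.induction_on with
      | empty => simp
      | insert j J hj ih =>
        have hstep : toChow M (Pm ∪ {Z}) (eltVar M (Pm ∪ {Z}) i₀) *
            toChow M (Pm ∪ {Z}) (pullbackPoly M Pm Z (eltVar M Pm j)) =
            toChow M (Pm ∪ {Z}) (eltVar M (Pm ∪ {Z}) i₀) *
            toChow M (Pm ∪ {Z}) (eltVar M (Pm ∪ {Z}) j) := by
          rw [pullbackPoly_eltVar]
          split_ifs with hjZ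
          · rw [map_add, mul_add, eltVar_mul_flatVar (F := centerFlat Pm Z) hi₀Z, add_zero]
          · rfl
        rw [Finset.prod_insert hj, Finset.prod_insert hj, mul_left_comm, ih, ← mul_assoc,
          mul_comm (toChow M (Pm ∪ {Z}) (pullbackPoly M Pm Z (eltVar M Pm j))), hstep, mul_assoc]
    have h0 : toChow M (Pm ∪ {Z}) (pullbackPoly M Pm Z (eltVar M Pm i₀)) =
        toChow M (Pm ∪ {Z}) (eltVar M (Pm ∪ {Z}) i₀) := by
      rw [pullbackPoly_eltVar, if_neg hi₀Z]
    rw [← Finset.mul_prod_erase I _ hi₀, h0, key, Finset.mul_prod_erase I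
      (fun i => toChow M (Pm ∪ {Z}) (eltVar M (Pm ∪ {Z}) i)) hi₀]
    refine prod_eltVar hI ?_
    rcases hcl with hcl | hcl
    · exact Or.inl (Or.inl hcl)
    · exact Or.inr hcl
  · rintro f ⟨i, j, -, rfl⟩
    rw [SetLike.mem_coe, Ideal.mem_comap, ← toChow_eq_zero_iff, map_sub, map_sub,
      pullbackPoly_linForm h, pullbackPoly_linForm h, sub_eq_zero]
    exact toChow_linForm _ _ _ _

/-- The pullback homomorphism `Φ_Z : A^*(M, P₋) → A^*(M, P₊)`. -/
noncomputable def pullback [M.Finite] (h : IsMatroidalFlip M Pm Z) :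
    ChowRing M Pm →ₐ[ℤ] ChowRing M (Pm ∪ {Z}) :=
  Ideal.quotientMapₐ (chowIdeal M (Pm ∪ {Z})) (pullbackPoly M Pm Z)
    (chowIdeal_le_comap_pullbackPoly h)

theorem pullback_toChow [M.Finite] (h : IsMatroidalFlip M Pm Z) (f : PolyRing M Pm) :
    pullback h (toChow M Pm f) = toChow M (Pm ∪ {Z}) (pullbackPoly M Pm Z f) := rfl

theorem pullbackPoly_isHomogeneous {f : PolyRing M Pm} {n : ℕ} (hf : f.IsHomogeneous n) :
    (pullbackPoly M Pm Z f).IsHomogeneous n := by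
  classical
  rw [← one_mul n]
  refine hf.aeval _ ?_
  rintro (i | F)
  · simp only [Sum.elim_inl]
    split_ifs
    · exact (MvPolynomial.isHomogeneous_X _ _).add (MvPolynomial.isHomogeneous_X _ _)
    · exact MvPolynomial.isHomogeneous_X _ _
  · exact MvPolynomial.isHomogeneous_X _ _

theorem pullback_mem_chowDeg [M.Finite] (h : IsMatroidalFlip M Pm Z) (q : ℤ) :
    ∀ x ∈ chowDeg M Pm q, (pullback h).toLinearMap x ∈ chowDeg M (Pm ∪ {Z}) q := by
  intro x hx
  unfold chowDeg at hx ⊢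
  split_ifs at hx ⊢
  · obtain ⟨f, hf, rfl⟩ := hx
    exact ⟨pullbackPoly M Pm Z f, pullbackPoly_isHomogeneous hf, rfl⟩
  · rw [Submodule.mem_bot] at hx ⊢
    rw [hx, map_zero]

/-- The degree `q` part `Φ_Z^q : A^q(M, P₋) → A^q(M, P₊)` of the pullback homomorphism. -/
noncomputable def pullbackDeg [M.Finite] (h : IsMatroidalFlip M Pm Z) (q : ℤ) :
    chowDeg M Pm q →ₗ[ℤ] chowDeg M (Pm ∪ {Z}) q :=
  (pullback h).toLinearMap.restrict (pullback_mem_chowDeg h q)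

end Pullback

/-! ### The Gysin homomorphisms -/

section Gysin

variable {M : Matroid α} {Pm : Set (Set α)} {Z : Set α}

/-- The homomorphism of polynomial rings sending `x_G`, for a proper flat `G` of `M ／ Z`, to
`x_{G ∪ Z}`, and sending every `x_i` to zero (these are zero in `A^*(M ／ Z)`). -/
noncomputable def gysinPoly (h : IsMatroidalFlip M Pm Z) :
    PolyRing (M ／ Z) (properFlats (M ／ Z)) →ₐ[ℤ] PolyRing M (Pm ∪ {Z}) :=
  MvPolynomial.aeval (Sum.elim (fun _ => 0)
    (fun G => flatVar M (Pm ∪ {Z}) ⟨(G : Set α) ∪ Z, Or.inl (h.union_mem G.2)⟩))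

theorem gysinPoly_eltVar (h : IsMatroidalFlip M Pm Z) (i : (M ／ Z).E) :
    gysinPoly h (eltVar (M ／ Z) (properFlats (M ／ Z)) i) = 0 := by
  rw [gysinPoly, eltVar, MvPolynomial.aeval_X, Sum.elim_inl]

theorem gysinPoly_flatVar (h : IsMatroidalFlip M Pm Z) (G : properFlats (M ／ Z)) :
    gysinPoly h (flatVar (M ／ Z) (properFlats (M ／ Z)) G) =
      flatVar M (Pm ∪ {Z}) ⟨(G : Set α) ∪ Z, Or.inl (h.union_mem G.2)⟩ := by
  rw [gysinPoly, flatVar, MvPolynomial.aeval_X, Sum.elim_inr]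

/-- An element of the ground set of `M ／ Z` seen as an element of the ground set of `M`. -/
def contractElt (M : Matroid α) (Z : Set α) (i : (M ／ Z).E) : M.E :=
  ⟨i, M.contract_ground_subset_ground Z i.2⟩

theorem contractElt_notMem (i : (M ／ Z).E) : (contractElt M Z i : α) ∉ Z := by
  obtain ⟨i, hi⟩ := i
  rw [Matroid.contract_ground] at hi
  exact hi.2

/-- The class of `x_Z` in `A^*(M, P₊)`. -/
noncomputable def centerClass (M : Matroid α) (Pm : Set (Set α)) (Z : Set α) :
    ChowRing M (Pm ∪ {Z}) :=
  toChow M (Pm ∪ {Z}) (flatVar M (Pm ∪ {Z}) (centerFlat Pm Z))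

theorem centerClass_mul_linForm [M.Finite] (h : IsMatroidalFlip M Pm Z) (i : (M ／ Z).E) :
    centerClass M Pm Z *
        toChow M (Pm ∪ {Z}) (gysinPoly h (linForm (M ／ Z) (properFlats (M ／ Z)) i)) =
      centerClass M Pm Z * toChow M (Pm ∪ {Z}) (linForm M (Pm ∪ {Z}) (contractElt M Z i)) := by
  classical
  have : Finite (Pm ∪ {Z} : Set (Set α)) := h.isOrderFilter_plus.finite
  have : (M ／ Z).Finite := ⟨M.ground_finite.subset Set.sdiff_subset⟩
  have : Finite (properFlats (M ／ Z)) := (finite_properFlats (M ／ Z)).to_subtype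
  have hiZ : (i : α) ∉ Z := contractElt_notMem i
  rw [linForm, linForm, map_add, map_add, map_add, gysinPoly_eltVar, map_zero, zero_add, mul_add,
    mul_comm _ (toChow M (Pm ∪ {Z}) (eltVar M (Pm ∪ {Z}) _)), centerClass,
    eltVar_mul_flatVar (i := contractElt M Z i) (F := centerFlat Pm Z) hiZ, zero_add, ← centerClass]
  have e1 := AddMonoidHom.map_finsum_mem (flatVar (M ／ Z) (properFlats (M ／ Z)))
    ((AddMonoidHom.mulLeft (centerClass M Pm Z)).comp
      ((toChow M (Pm ∪ {Z})).comp (gysinPoly h)).toLinearMap.toAddMonoidHom)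
    (Set.toFinite {G : properFlats (M ／ Z) | (i : α) ∈ (G : Set α)})
  have e2 := AddMonoidHom.map_finsum_mem (flatVar M (Pm ∪ {Z}))
    ((AddMonoidHom.mulLeft (centerClass M Pm Z)).comp
      (toChow M (Pm ∪ {Z})).toLinearMap.toAddMonoidHom)
    (Set.toFinite {F : (Pm ∪ {Z} : Set (Set α)) | (i : α) ∈ (F : Set α)})
  refine e1.trans (Eq.trans ?_ e2.symm)
  let g : properFlats (M ／ Z) → (Pm ∪ {Z} : Set (Set α)) :=
    fun G => ⟨(G : Set α) ∪ Z, Or.inl (h.union_mem G.2)⟩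
  have hg : Function.Injective g := by
    intro G G' hGG
    have h1 : (G : Set α) ∪ Z = (G' : Set α) ∪ Z := congrArg Subtype.val hGG
    have d1 := (h.mem_properFlats_contract.1 G.2).1
    have d2 := (h.mem_properFlats_contract.1 G'.2).1
    apply Subtype.ext
    rw [← d1.sdiff_eq_left, ← d2.sdiff_eq_left, ← Set.union_sdiff_right, h1, Set.union_sdiff_right]
  have e3 : ∑ᶠ G ∈ {G : properFlats (M ／ Z) | (i : α) ∈ (G : Set α)},
      centerClass M Pm Z * toChow M (Pm ∪ {Z}) (flatVar M (Pm ∪ {Z}) (g G)) =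
      ∑ᶠ F ∈ g '' {G : properFlats (M ／ Z) | (i : α) ∈ (G : Set α)},
        centerClass M Pm Z * toChow M (Pm ∪ {Z}) (flatVar M (Pm ∪ {Z}) F) := by
    rw [finsum_mem_image hg.injOn]
  refine Eq.trans ?_ (e3.trans ?_)
  · refine finsum_congr fun G => finsum_congr fun _ => ?_
    change centerClass M Pm Z * toChow M (Pm ∪ {Z}) (gysinPoly h _) = _
    rw [gysinPoly_flatVar]
  · refine finsum_mem_inter_support_eq' _ _ _ fun F hF => ⟨?_, fun hiF => ?_⟩
    · rintro ⟨G, hG, rfl⟩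
      exact Or.inl hG
    · have hne : ¬ (F : Set α) ⊆ Z := fun hs => hiZ (hs hiF)
      have hZF : Z ⊆ (F : Set α) := by
        by_contra hZF
        exact hF (flatVar_mul_flatVar (F := centerFlat Pm Z) hZF hne)
      have hu : (F : Set α) \ Z ∪ Z = F := Set.sdiff_union_of_subset hZF
      refine ⟨⟨(F : Set α) \ Z, h.mem_properFlats_contract.2
        ⟨Set.disjoint_sdiff_left, ⟨i, hiF, hiZ⟩, ?_⟩⟩, ⟨hiF, hiZ⟩, Subtype.ext hu⟩
      rw [hu]
      exact h.isOrderFilter_plus.subset_properFlats F.2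

theorem centerClass_mul_gysinPoly [M.Finite] (h : IsMatroidalFlip M Pm Z)
    {f : PolyRing (M ／ Z) (properFlats (M ／ Z))}
    (hf : f ∈ chowIdeal (M ／ Z) (properFlats (M ／ Z))) :
    centerClass M Pm Z * toChow M (Pm ∪ {Z}) (gysinPoly h f) = 0 := by
  classical
  let J : Ideal (PolyRing (M ／ Z) (properFlats (M ／ Z))) :=
    Ideal.comap ((toChow M (Pm ∪ {Z})).comp (gysinPoly h)).toRingHom
      (LinearMap.ker (LinearMap.mulLeft (ChowRing M (Pm ∪ {Z})) (centerClass M Pm Z)))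
  have hJ : ∀ g, g ∈ J ↔ centerClass M Pm Z * toChow M (Pm ∪ {Z}) (gysinPoly h g) = 0 :=
    fun g => Iff.rfl
  have hle : chowIdeal (M ／ Z) (properFlats (M ／ Z)) ≤ J := by
    refine chowIdeal_le ?_ ?_ ?_ ?_
    · rintro f ⟨F, G, hFG, hGF, rfl⟩
      rw [SetLike.mem_coe, hJ, map_mul, map_mul, gysinPoly_flatVar, gysinPoly_flatVar,
        flatVar_mul_flatVar, mul_zero]
      · exact fun hs => hFG fun x hx => (hs (Or.inl hx)).resolve_right
          (Set.disjoint_left.1 (h.mem_properFlats_contract.1 F.2).1 hx)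
      · exact fun hs => hGF fun x hx => (hs (Or.inl hx)).resolve_right
          (Set.disjoint_left.1 (h.mem_properFlats_contract.1 G.2).1 hx)
    · rintro f ⟨i, F, -, rfl⟩
      rw [SetLike.mem_coe, hJ, map_mul, gysinPoly_eltVar, zero_mul, map_zero, mul_zero]
    · rintro f ⟨I, -, hcl, rfl⟩
      rw [SetLike.mem_coe, hJ]
      rcases I.eq_empty_or_nonempty with rfl | ⟨i, hi⟩
      · exfalso
        rw [Finset.coe_empty, Set.image_empty, Matroid.contract_closure_eq, Set.empty_union,
          h.isFlat.closure, Set.sdiff_self] at hcl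
        rcases hcl with hcl | hcl
        · exact Set.not_nonempty_empty hcl.2.1
        · rw [Set.mem_singleton_iff, Matroid.contract_ground, eq_comm, Set.sdiff_eq_empty] at hcl
          exact h.ne_ground (h.isFlat.subset_ground.antisymm hcl)
      · rw [map_prod, Finset.prod_eq_zero hi (gysinPoly_eltVar h i), map_zero, mul_zero]
    · rintro f ⟨i, j, -, rfl⟩
      rw [SetLike.mem_coe, hJ, map_sub, map_sub, mul_sub, centerClass_mul_linForm,
        centerClass_mul_linForm, toChow_linForm M (Pm ∪ {Z}) (contractElt M Z i) (contractElt M Z j), sub_self]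
  exact (hJ f).1 (hle hf)

/-- The group homomorphism `A^*(M ／ Z) → A^*(M, P₊)` sending the monomial `x_𝓕` of a flag `𝓕` of
proper flats of `M ／ Z` (identified with a flag of flats of `M` strictly containing `Z`) to
`x_Z ^ p * x_𝓕`. It is well defined since `p` is positive. -/
noncomputable def gysin [M.Finite] (h : IsMatroidalFlip M Pm Z) (p : ℕ) (hp : 1 ≤ p) :
    ChowRing (M ／ Z) (properFlats (M ／ Z)) →ₗ[ℤ] ChowRing M (Pm ∪ {Z}) :=
  (((chowIdeal (M ／ Z) (properFlats (M ／ Z))).restrictScalars ℤ).liftQ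
    ((LinearMap.mulLeft ℤ (centerClass M Pm Z ^ p)).comp
      ((toChow M (Pm ∪ {Z})).comp (gysinPoly h)).toLinearMap) (by
        intro f hf
        obtain ⟨m, rfl⟩ := Nat.exists_eq_add_of_le' hp
        change centerClass M Pm Z ^ (m + 1) * toChow M (Pm ∪ {Z}) (gysinPoly h f) = 0
        rw [pow_succ, mul_assoc, centerClass_mul_gysinPoly h hf, mul_zero])).comp
  (Submodule.Quotient.restrictScalarsEquiv ℤ
    (chowIdeal (M ／ Z) (properFlats (M ／ Z)))).symm.toLinearMap

theorem gysin_toChow [M.Finite] (h : IsMatroidalFlip M Pm Z) (p : ℕ) (hp : 1 ≤ p)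
    (f : PolyRing (M ／ Z) (properFlats (M ／ Z))) :
    gysin h p hp (toChow (M ／ Z) (properFlats (M ／ Z)) f) =
      centerClass M Pm Z ^ p * toChow M (Pm ∪ {Z}) (gysinPoly h f) := rfl

theorem gysinPoly_isHomogeneous (h : IsMatroidalFlip M Pm Z)
    {f : PolyRing (M ／ Z) (properFlats (M ／ Z))} {n : ℕ} (hf : f.IsHomogeneous n) :
    (gysinPoly h f).IsHomogeneous n := by
  rw [← one_mul n]
  refine hf.aeval _ ?_
  rintro (i | F)
  · exact MvPolynomial.isHomogeneous_zero _ _ _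
  · exact MvPolynomial.isHomogeneous_X _ _

theorem gysin_mem_chowDeg [M.Finite] (h : IsMatroidalFlip M Pm Z) (p : ℕ) (hp : 1 ≤ p) (q : ℤ) :
    ∀ x ∈ chowDeg (M ／ Z) (properFlats (M ／ Z)) (q - p),
      gysin h p hp x ∈ chowDeg M (Pm ∪ {Z}) q := by
  intro x hx
  unfold chowDeg at hx
  split_ifs at hx with hpq
  · obtain ⟨f, hf, rfl⟩ := hx
    rw [chowDeg, if_pos (by omega)]
    refine ⟨flatVar M (Pm ∪ {Z}) (centerFlat Pm Z) ^ p * gysinPoly h f, ?_, ?_⟩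
    · have h1 := ((MvPolynomial.isHomogeneous_X ℤ
        (Sum.inr (centerFlat Pm Z) : M.E ⊕ (Pm ∪ {Z} : Set (Set α)))).pow p).mul
        (gysinPoly_isHomogeneous h hf)
      have h2 : 1 * p + (q - p).toNat = q.toNat := by omega
      rw [h2] at h1
      exact h1
    · change toChow M (Pm ∪ {Z}) _ = gysin h p hp (toChow _ _ f)
      rw [gysin_toChow, map_mul, map_pow, centerClass]
  · rw [Submodule.mem_bot] at hx
    rw [hx, map_zero]
    exact zero_mem _

/-- The Gysin homomorphism `Ψ_Z^{p,q} : A^{q-p}(M ／ Z) → A^q(M, P₊)`. -/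
noncomputable def gysinDeg [M.Finite] (h : IsMatroidalFlip M Pm Z) (p : ℕ) (hp : 1 ≤ p) (q : ℤ) :
    chowDeg (M ／ Z) (properFlats (M ／ Z)) (q - p) →ₗ[ℤ] chowDeg M (Pm ∪ {Z}) q :=
  (gysin h p hp).restrict (gysin_mem_chowDeg h p hp q)

/-- The sum of the pullback homomorphism and the Gysin homomorphisms,
`Φ_Z^q ⊕ ⨁_{1 ≤ p ≤ rk(Z) - 1} Ψ_Z^{p,q}`. -/
noncomputable def decompositionMap [M.Finite] (h : IsMatroidalFlip M Pm Z) (q : ℤ) :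
    (chowDeg M Pm q ×
      ⨁ p : {p : ℕ // 1 ≤ p ∧ (p : ℕ∞) < M.eRk Z},
        chowDeg (M ／ Z) (properFlats (M ／ Z)) (q - (p : ℕ))) →ₗ[ℤ]
    chowDeg M (Pm ∪ {Z}) q :=
  (pullbackDeg h q).coprod
    (DirectSum.toModule ℤ _ _ fun p => gysinDeg h (p : ℕ) p.2.1 q)

end Gysin

end MatroidChow

namespace MatroidChow

variable {α : Type*}

/-! ### Linear forms and element classes -/

/-! This is the blow-up formula for Chow rings, in the style of Keel. Write R = A^*(M, P₋), S =
A^*(M, P₊), T = A^*(M ／ Z), d = rk Z and u = x_Z. As for the inclusion of a blow-up center, there is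
a surjective restriction ρ : R → T. It sends x_F to x_{F \ Z} if Z ⊆ F and to 0 otherwise, x_i to 0
for i ∉ Z, and x_i to one common class β for i ∈ Z. The ring S behaves like R[X] modulo X · ker ρ
and the polynomial b(X) = ∏ (x_i - X), taken over a basis B of Z, with X standing for u. Dividing by
b leaves remainders of degree less than d, whose constant term lies in R and whose higher
coefficients matter only modulo ker ρ, that is, as elements of T. This is the asserted
decomposition.

Only two halves of this picture are needed. For injectivity, the relations of S are mapped into the
ideal of the model (`chowIdeal_le_comap_blowPoly`), and no nontrivial remainder lies in that ideal
(`map_eq_zero_of_mem_blowIdeal`): ρ turns b into (β - X)^d, which is monic up to sign, and the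
constant terms are controlled by ker ρ · ∏_{i ∈ B} x_i = 0. The last fact rests on the generators of
ker ρ found in `mem_centerIdeal_of_restriction_eq_zero`.

For surjectivity, the elements u^p Φ(r) with p < d span S, because x_i = Φ(x_i) - u for i ∈ Z turns
the closure relation of B into an expression of u^d through lower powers. The projection formula
`gysin_restriction` identifies u^p Φ(r), for p ≥ 1, with the Gysin image of ρ(r). -/

open Classical in
theorem map_linForm {M : Matroid α} {P : Set (Set α)} [Fintype P] {A : Type*} [Semiring A]
    [Algebra ℤ A] (φ : PolyRing M P →ₐ[ℤ] A) (i : M.E) :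
    φ (linForm M P i) = φ (eltVar M P i) +
      ∑ F : P, if (i : α) ∈ (F : Set α) then φ (flatVar M P F) else 0 := by
  rw [linForm, map_add, finsum_mem_def, finsum_eq_sum_of_fintype, map_sum]
  congr 1
  refine Finset.sum_congr rfl fun F _ => ?_
  by_cases hF : (i : α) ∈ (F : Set α) <;> simp [Set.indicator, hF]

open Classical in
/-- The common class of the linear forms `x_i + ∑_{i ∈ F ∈ P} x_F`. -/
noncomputable def linClass (M : Matroid α) (P : Set (Set α)) : ChowRing M P :=
  if hE : Nonempty M.E then toChow M P (linForm M P hE.some) else 0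

theorem toChow_linForm_eq (M : Matroid α) (P : Set (Set α)) (i : M.E) :
    toChow M P (linForm M P i) = linClass M P := by
  have hE : Nonempty M.E := ⟨i⟩
  rw [linClass, dif_pos hE]
  exact toChow_linForm M P i _

/-- Without loops, {i} is independent and its closure is either a nonempty proper flat or the ground
set, so x_i is itself a closure relation. -/
theorem toChow_eltVar_eq_zero (M : Matroid α) [M.Loopless] (i : M.E) :
    toChow M (properFlats M) (eltVar M (properFlats M) i) = 0 := by
  have himg : Subtype.val '' ((({i} : Finset M.E) : Set M.E)) = {(i : α)} := by simp
  have hp := prod_eltVar (M := M) (P := properFlats M) (I := {i}) (by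
    rw [himg, Matroid.indep_singleton]
    exact Matroid.isNonloop_of_loopless i.2) (by
    rw [himg]
    by_cases hcl : M.closure {(i : α)} = M.E
    · exact Or.inr hcl
    · exact Or.inl ⟨M.isFlat_closure _, ⟨i, M.mem_closure_self _ i.2⟩, hcl⟩)
  simpa using hp

/-! ### Flats containing the center and flats of the contraction -/

namespace IsMatroidalFlip

variable {M : Matroid α} {Pm : Set (Set α)} {Z : Set α}

theorem loopless_contract (h : IsMatroidalFlip M Pm Z) : (M ／ Z).Loopless := by
  rw [Matroid.loopless_iff, Matroid.contract_loops_eq, h.isFlat.closure, Set.sdiff_self]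

/-- A proper flat `G` of `M ／ Z` seen as the flat `G ∪ Z` of `Pm`. -/
def joinFlat (h : IsMatroidalFlip M Pm Z) (G : properFlats (M ／ Z)) : Pm :=
  ⟨(G : Set α) ∪ Z, h.union_mem G.2⟩

/-- A flat of `Pm` containing `Z` seen as a proper flat of `M ／ Z`. -/
def contractFlat (h : IsMatroidalFlip M Pm Z) (F : Pm) (hF : Z ⊆ (F : Set α)) :
    properFlats (M ／ Z) :=
  ⟨(F : Set α) \ Z, by
    rw [h.mem_properFlats_contract, Set.sdiff_union_of_subset hF]
    exact ⟨Set.disjoint_sdiff_left, Set.sdiff_nonempty.2 (h.not_subset F.2),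
      h.isOrderFilter.subset_properFlats F.2⟩⟩

theorem joinFlat_contractFlat (h : IsMatroidalFlip M Pm Z) (F : Pm) (hF : Z ⊆ (F : Set α)) :
    h.joinFlat (h.contractFlat F hF) = F :=
  Subtype.ext (Set.sdiff_union_of_subset hF)

theorem subset_joinFlat (h : IsMatroidalFlip M Pm Z) (G : properFlats (M ／ Z)) :
    Z ⊆ (h.joinFlat G : Set α) := Set.subset_union_right

theorem contractFlat_joinFlat (h : IsMatroidalFlip M Pm Z) (G : properFlats (M ／ Z)) :
    h.contractFlat (h.joinFlat G) (h.subset_joinFlat G) = G := by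
  refine Subtype.ext ?_
  change ((G : Set α) ∪ Z) \ Z = G
  rw [Set.union_sdiff_right, (h.mem_properFlats_contract.1 G.2).1.sdiff_eq_left]

theorem joinFlat_injective (h : IsMatroidalFlip M Pm Z) : Function.Injective h.joinFlat := by
  intro G G' hG
  rw [← h.contractFlat_joinFlat G, ← h.contractFlat_joinFlat G']
  congr 1

theorem mem_range_joinFlat (h : IsMatroidalFlip M Pm Z) {F : Pm} :
    F ∈ Set.range h.joinFlat ↔ Z ⊆ (F : Set α) :=
  ⟨by rintro ⟨G, rfl⟩; exact h.subset_joinFlat G, fun hF => ⟨_, h.joinFlat_contractFlat F hF⟩⟩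

theorem sum_joinFlat (h : IsMatroidalFlip M Pm Z) [Fintype Pm] [Fintype (properFlats (M ／ Z))]
    {A : Type*} [AddCommMonoid A] (f : Pm → A) (hf : ∀ F : Pm, ¬ Z ⊆ (F : Set α) → f F = 0) :
    ∑ F, f F = ∑ G, f (h.joinFlat G) :=
  (Fintype.sum_of_injective h.joinFlat h.joinFlat_injective _ f
    (fun F hF => hf F fun hZ => hF (h.mem_range_joinFlat.2 hZ)) fun _ => rfl).symm

theorem mem_joinFlat (h : IsMatroidalFlip M Pm Z) {i : α} (hi : i ∉ Z)
    {G : properFlats (M ／ Z)} : i ∈ (h.joinFlat G : Set α) ↔ i ∈ (G : Set α) :=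
  ⟨fun hG => hG.resolve_right hi, Or.inl⟩

theorem exists_notMem (h : IsMatroidalFlip M Pm Z) : ∃ j : M.E, (j : α) ∉ Z := by
  by_contra! hcon
  exact h.ne_ground (h.isFlat.subset_ground.antisymm fun x hx => hcon ⟨x, hx⟩)

theorem finite_properFlats_contract (h : IsMatroidalFlip M Pm Z) [M.Finite] :
    Finite (properFlats (M ／ Z)) :=
  have := h.isOrderFilter.finite
  Finite.of_injective _ h.joinFlat_injective

/-- An element of `E \ Z` seen as an element of the ground set of `M ／ Z`. -/
def toContract (_ : IsMatroidalFlip M Pm Z) (i : M.E) (hi : (i : α) ∉ Z) : (M ／ Z).E :=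
  ⟨i, by rw [Matroid.contract_ground]; exact ⟨i.2, hi⟩⟩

end IsMatroidalFlip

/-! ### Restriction to the center -/

section Restriction

variable {M : Matroid α} {Pm : Set (Set α)} {Z : Set α}

/-- The class in `A^*(M ／ Z)` of the restriction of `x_i`, for `i ∈ Z`. -/
noncomputable def normalClass (M : Matroid α) (Z : Set α) :
    ChowRing (M ／ Z) (properFlats (M ／ Z)) :=
  linClass (M ／ Z) (properFlats (M ／ Z)) -
    ∑ᶠ G, toChow (M ／ Z) (properFlats (M ／ Z)) (flatVar (M ／ Z) (properFlats (M ／ Z)) G)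

open Classical in
/-- The restriction to the center, on polynomials. -/
noncomputable def restrictPoly (h : IsMatroidalFlip M Pm Z) :
    PolyRing M Pm →ₐ[ℤ] ChowRing (M ／ Z) (properFlats (M ／ Z)) :=
  MvPolynomial.aeval (Sum.elim
    (fun i => if (i : α) ∈ Z then normalClass M Z else 0)
    (fun F => if hF : Z ⊆ (F : Set α) then toChow (M ／ Z) (properFlats (M ／ Z))
      (flatVar (M ／ Z) (properFlats (M ／ Z)) (h.contractFlat F hF)) else 0))

theorem restrictPoly_eltVar_of_mem (h : IsMatroidalFlip M Pm Z) {i : M.E} (hi : (i : α) ∈ Z) :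
    restrictPoly h (eltVar M Pm i) = normalClass M Z := by
  simp [restrictPoly, eltVar, hi]

theorem restrictPoly_eltVar_of_notMem (h : IsMatroidalFlip M Pm Z) {i : M.E} (hi : (i : α) ∉ Z) :
    restrictPoly h (eltVar M Pm i) = 0 := by
  simp [restrictPoly, eltVar, hi]

theorem restrictPoly_flatVar_of_not_subset (h : IsMatroidalFlip M Pm Z) {F : Pm}
    (hF : ¬ Z ⊆ (F : Set α)) : restrictPoly h (flatVar M Pm F) = 0 := by
  simp [restrictPoly, flatVar, hF]

theorem restrictPoly_flatVar (h : IsMatroidalFlip M Pm Z) {F : Pm} (hF : Z ⊆ (F : Set α)) :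
    restrictPoly h (flatVar M Pm F) = toChow (M ／ Z) (properFlats (M ／ Z))
      (flatVar (M ／ Z) (properFlats (M ／ Z)) (h.contractFlat F hF)) := by
  simp [restrictPoly, flatVar, hF]

theorem restrictPoly_flatVar_joinFlat (h : IsMatroidalFlip M Pm Z) (G : properFlats (M ／ Z)) :
    restrictPoly h (flatVar M Pm (h.joinFlat G)) = toChow (M ／ Z) (properFlats (M ／ Z))
      (flatVar (M ／ Z) (properFlats (M ／ Z)) G) := by
  rw [restrictPoly_flatVar h (h.subset_joinFlat G), h.contractFlat_joinFlat]

/-- This forces the form of `normalClass`. Only flats containing Z survive; if i ∈ Z, all of them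
contain i, so the image of x_i must be the linear class minus the sum of all x_G. If i ∉ Z, what
remains is the linear form of i in M ／ Z, where x_i = 0. -/
theorem restrictPoly_linForm [M.Finite] (h : IsMatroidalFlip M Pm Z) (i : M.E) :
    restrictPoly h (linForm M Pm i) = linClass (M ／ Z) (properFlats (M ／ Z)) := by
  classical
  have := h.isOrderFilter.finite
  have := h.finite_properFlats_contract
  have := h.loopless_contract
  let := Fintype.ofFinite Pm
  let := Fintype.ofFinite (properFlats (M ／ Z))
  rw [map_linForm, h.sum_joinFlat _ fun F hF => by
    rw [restrictPoly_flatVar_of_not_subset h hF, ite_self]]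
  simp only [restrictPoly_flatVar_joinFlat]
  by_cases hi : (i : α) ∈ Z
  · rw [restrictPoly_eltVar_of_mem h hi, normalClass, finsum_eq_sum_of_fintype]
    simp [h.subset_joinFlat _ hi]
  · rw [restrictPoly_eltVar_of_notMem h hi, ← toChow_linForm_eq _ _ (h.toContract i hi),
      map_linForm, toChow_eltVar_eq_zero]
    simp only [h.mem_joinFlat hi]
    rfl

/-- Otherwise the closure of I would lie in the flat Z, which contains no member of P₋ and is not
the ground set. -/
theorem exists_mem_notMem_center (h : IsMatroidalFlip M Pm Z) {I : Finset M.E}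
    (hcl : M.closure (Subtype.val '' (I : Set M.E)) ∈ Pm ∪ {M.E}) :
    ∃ i ∈ I, (i : α) ∉ Z := by
  by_contra! hcon
  have hsub : M.closure (Subtype.val '' (I : Set M.E)) ⊆ Z := by
    rw [← h.isFlat.closure]
    refine M.closure_subset_closure ?_
    rintro _ ⟨i, hi, rfl⟩
    exact hcon i hi
  rcases hcl with hcl | hcl
  · exact h.not_subset hcl hsub
  · rw [Set.mem_singleton_iff] at hcl
    exact h.ne_ground (h.isFlat.subset_ground.antisymm (hcl ▸ hsub))

theorem chowIdeal_le_ker_restrictPoly [M.Finite] (h : IsMatroidalFlip M Pm Z) :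
    chowIdeal M Pm ≤ RingHom.ker (restrictPoly h) := by
  classical
  refine chowIdeal_le ?_ ?_ ?_ ?_
  · rintro f ⟨F, G, hFG, hGF, rfl⟩
    rw [SetLike.mem_coe, RingHom.mem_ker, map_mul]
    by_cases hF : Z ⊆ (F : Set α)
    · by_cases hG : Z ⊆ (G : Set α)
      · rw [restrictPoly_flatVar h hF, restrictPoly_flatVar h hG]
        refine flatVar_mul_flatVar (fun hs => hFG ?_) (fun hs => hGF ?_)
        · exact (Set.sdiff_subset_iff.1 hs).trans_eq (Set.union_sdiff_cancel hG)
        · exact (Set.sdiff_subset_iff.1 hs).trans_eq (Set.union_sdiff_cancel hF)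
      · rw [restrictPoly_flatVar_of_not_subset h hG, mul_zero]
    · rw [restrictPoly_flatVar_of_not_subset h hF, zero_mul]
  · rintro f ⟨i, F, hiF, rfl⟩
    rw [SetLike.mem_coe, RingHom.mem_ker, map_mul]
    by_cases hi : (i : α) ∈ Z
    · rw [restrictPoly_flatVar_of_not_subset h fun hs => hiF (hs hi), mul_zero]
    · rw [restrictPoly_eltVar_of_notMem h hi, zero_mul]
  · rintro f ⟨I, -, hcl, rfl⟩
    obtain ⟨i, hi, hiZ⟩ := exists_mem_notMem_center h hcl
    rw [SetLike.mem_coe, RingHom.mem_ker, map_prod,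
      Finset.prod_eq_zero hi (restrictPoly_eltVar_of_notMem h hiZ)]
  · rintro f ⟨i, j, -, rfl⟩
    rw [SetLike.mem_coe, RingHom.mem_ker, map_sub, restrictPoly_linForm, restrictPoly_linForm,
      sub_self]

/-- The restriction homomorphism `A^*(M, P₋) → A^*(M ／ Z)` to the center of the flip. -/
noncomputable def restriction [M.Finite] (h : IsMatroidalFlip M Pm Z) :
    ChowRing M Pm →+* ChowRing (M ／ Z) (properFlats (M ／ Z)) :=
  (Ideal.Quotient.liftₐ (chowIdeal M Pm) (restrictPoly h) fun _ ha =>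
    chowIdeal_le_ker_restrictPoly h ha).toRingHom

theorem restriction_toChow [M.Finite] (h : IsMatroidalFlip M Pm Z) (f : PolyRing M Pm) :
    restriction h (toChow M Pm f) = restrictPoly h f := rfl

/-- The lift of `A^*(M ／ Z)` to `A^*(M, P₋)` sending `x_G` to `x_{G ∪ Z}` and every `x_i` to zero,
on polynomials. -/
noncomputable def joinPoly (h : IsMatroidalFlip M Pm Z) :
    PolyRing (M ／ Z) (properFlats (M ／ Z)) →ₐ[ℤ] PolyRing M Pm :=
  MvPolynomial.aeval (Sum.elim (fun _ => 0) (fun G => flatVar M Pm (h.joinFlat G)))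

theorem joinPoly_eltVar (h : IsMatroidalFlip M Pm Z) (i : (M ／ Z).E) :
    joinPoly h (eltVar (M ／ Z) (properFlats (M ／ Z)) i) = 0 := by
  rw [joinPoly, eltVar, MvPolynomial.aeval_X, Sum.elim_inl]

theorem joinPoly_flatVar (h : IsMatroidalFlip M Pm Z) (G : properFlats (M ／ Z)) :
    joinPoly h (flatVar (M ／ Z) (properFlats (M ／ Z)) G) = flatVar M Pm (h.joinFlat G) := by
  rw [joinPoly, flatVar, MvPolynomial.aeval_X, Sum.elim_inr]

/-- Homomorphisms out of the polynomial ring agree if they agree on all variables. -/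
theorem polyRing_hom_ext {P : Set (Set α)} {A : Type*} [Semiring A] [Algebra ℤ A]
    {φ ψ : PolyRing M P →ₐ[ℤ] A}
    (h1 : ∀ i, φ (eltVar M P i) = ψ (eltVar M P i))
    (h2 : ∀ F, φ (flatVar M P F) = ψ (flatVar M P F)) : φ = ψ :=
  MvPolynomial.algHom_ext <| by
    rintro (i | F)
    exacts [h1 i, h2 F]

/-- A section of the restriction at the level of polynomials, so the restriction is surjective. The
section respects the relations of M ／ Z only after the center ideal is killed. -/
theorem restrictPoly_joinPoly [M.Finite] (h : IsMatroidalFlip M Pm Z)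
    (f : PolyRing (M ／ Z) (properFlats (M ／ Z))) :
    restrictPoly h (joinPoly h f) = toChow (M ／ Z) (properFlats (M ／ Z)) f := by
  have := h.loopless_contract
  refine DFunLike.congr_fun (polyRing_hom_ext (φ := (restrictPoly h).comp (joinPoly h))
    (fun i => ?_) (fun G => ?_)) f
  · rw [AlgHom.comp_apply, joinPoly_eltVar, map_zero, toChow_eltVar_eq_zero]
  · rw [AlgHom.comp_apply, joinPoly_flatVar, restrictPoly_flatVar_joinFlat]

theorem pullbackPoly_joinPoly (h : IsMatroidalFlip M Pm Z)
    (f : PolyRing (M ／ Z) (properFlats (M ／ Z))) :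
    pullbackPoly M Pm Z (joinPoly h f) = gysinPoly h f := by
  refine DFunLike.congr_fun (polyRing_hom_ext (φ := (pullbackPoly M Pm Z).comp (joinPoly h))
    (fun i => ?_) (fun G => ?_)) f
  · rw [AlgHom.comp_apply, joinPoly_eltVar, map_zero, gysinPoly_eltVar]
  · rw [AlgHom.comp_apply, joinPoly_flatVar, pullbackPoly_flatVar, gysinPoly_flatVar]
    rfl

/-! ### The kernel of the restriction -/

/-- The ideal of `A^*(M, P₋)` generated by the `x_i` with `i ∉ Z` and the `x_F` with `Z ⊈ F`. -/
noncomputable def centerIdeal (M : Matroid α) (Pm : Set (Set α)) (Z : Set α) :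
    Ideal (ChowRing M Pm) :=
  Ideal.span ({a | ∃ i : M.E, (i : α) ∉ Z ∧ a = toChow M Pm (eltVar M Pm i)} ∪
    {a | ∃ F : Pm, ¬ Z ⊆ (F : Set α) ∧ a = toChow M Pm (flatVar M Pm F)})

theorem eltVar_mem_centerIdeal {i : M.E} (hi : (i : α) ∉ Z) :
    toChow M Pm (eltVar M Pm i) ∈ centerIdeal M Pm Z :=
  Ideal.subset_span (Or.inl ⟨i, hi, rfl⟩)

theorem flatVar_mem_centerIdeal {F : Pm} (hF : ¬ Z ⊆ (F : Set α)) :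
    toChow M Pm (flatVar M Pm F) ∈ centerIdeal M Pm Z :=
  Ideal.subset_span (Or.inr ⟨F, hF, rfl⟩)

/-- A homomorphism out of the polynomial ring of `(M, P₋)` that factors through the quotient of
`A^*(M, P₋)` by the center ideal. -/
structure KillsCenter {A : Type*} [CommRing A] [Algebra ℤ A] (Z : Set α)
    (φ : PolyRing M Pm →ₐ[ℤ] A) : Prop where
  chowIdeal_le : ∀ f ∈ chowIdeal M Pm, φ f = 0
  map_eltVar : ∀ i : M.E, (i : α) ∉ Z → φ (eltVar M Pm i) = 0
  map_flatVar : ∀ F : Pm, ¬ Z ⊆ (F : Set α) → φ (flatVar M Pm F) = 0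

/-! ### Factoring homomorphisms through the restriction -/

section KillsCenter

variable {A : Type*} [CommRing A] [Algebra ℤ A] {φ : PolyRing M Pm →ₐ[ℤ] A}

theorem KillsCenter.map_linForm_eq (hφ : KillsCenter Z φ) (i j : M.E) :
    φ (linForm M Pm i) = φ (linForm M Pm j) := by
  rw [← sub_eq_zero, ← map_sub]
  refine hφ.chowIdeal_le _ ?_
  rw [← toChow_eq_zero_iff, map_sub, toChow_linForm M Pm i j, sub_self]

theorem KillsCenter.map_joinPoly_linForm [M.Finite] (h : IsMatroidalFlip M Pm Z)
    (hφ : KillsCenter Z φ) (i : (M ／ Z).E) :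
    φ (joinPoly h (linForm (M ／ Z) (properFlats (M ／ Z)) i)) =
      φ (linForm M Pm (contractElt M Z i)) := by
  classical
  have := h.isOrderFilter.finite
  have := h.finite_properFlats_contract
  let := Fintype.ofFinite Pm
  let := Fintype.ofFinite (properFlats (M ／ Z))
  have hi : (i : α) ∉ Z := contractElt_notMem i
  rw [← AlgHom.comp_apply, map_linForm, map_linForm, hφ.map_eltVar _ hi, AlgHom.comp_apply,
    joinPoly_eltVar, map_zero, h.sum_joinFlat _ fun F hF => by rw [hφ.map_flatVar F hF, ite_self]]
  congr 1
  refine Finset.sum_congr rfl fun G _ => ?_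
  rw [AlgHom.comp_apply, joinPoly_flatVar,
    show ((contractElt M Z i : α) ∈ (h.joinFlat G : Set α)) ↔ (i : α) ∈ (G : Set α) from
    h.mem_joinFlat hi]

/-- As Z is a flat, the empty set is closed in M ／ Z; it is neither a nonempty flat nor the ground
set. Hence every closure relation of M ／ Z contains some x_i. -/
theorem closureRel_contract_exists (h : IsMatroidalFlip M Pm Z) {I : Finset (M ／ Z).E}
    (hcl : (M ／ Z).closure (Subtype.val '' (I : Set (M ／ Z).E)) ∈
      properFlats (M ／ Z) ∪ {(M ／ Z).E}) : I.Nonempty := by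
  rw [Finset.nonempty_iff_ne_empty]
  rintro rfl
  rw [Finset.coe_empty, Set.image_empty, Matroid.contract_closure_eq, Set.empty_union,
    h.isFlat.closure, Set.sdiff_self] at hcl
  rcases hcl with hcl | hcl
  · exact Set.not_nonempty_empty hcl.2.1
  · rw [Set.mem_singleton_iff, Matroid.contract_ground, eq_comm, Set.sdiff_eq_empty] at hcl
    exact h.ne_ground (h.isFlat.subset_ground.antisymm hcl)

theorem KillsCenter.chowIdeal_contract_le [M.Finite] (h : IsMatroidalFlip M Pm Z)
    (hφ : KillsCenter Z φ) :
    chowIdeal (M ／ Z) (properFlats (M ／ Z)) ≤ RingHom.ker (φ.comp (joinPoly h)) := by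
  refine MatroidChow.chowIdeal_le ?_ ?_ ?_ ?_
  · rintro f ⟨F, G, hFG, hGF, rfl⟩
    rw [SetLike.mem_coe, RingHom.mem_ker, AlgHom.comp_apply, map_mul, joinPoly_flatVar,
      joinPoly_flatVar]
    refine hφ.chowIdeal_le _ ?_
    rw [← toChow_eq_zero_iff, map_mul]
    refine flatVar_mul_flatVar (fun hs => hFG fun x hx => ?_) (fun hs => hGF fun x hx => ?_)
    · exact (hs (Or.inl hx)).resolve_right
          (Set.disjoint_left.1 (h.mem_properFlats_contract.1 F.2).1 hx)
    · exact (hs (Or.inl hx)).resolve_right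
          (Set.disjoint_left.1 (h.mem_properFlats_contract.1 G.2).1 hx)
  · rintro f ⟨i, F, -, rfl⟩
    rw [SetLike.mem_coe, RingHom.mem_ker, AlgHom.comp_apply, map_mul, joinPoly_eltVar, zero_mul,
      map_zero]
  · rintro f ⟨I, -, hcl, rfl⟩
    obtain ⟨i, hi⟩ := closureRel_contract_exists h hcl
    rw [SetLike.mem_coe, RingHom.mem_ker, AlgHom.comp_apply, map_prod,
      Finset.prod_eq_zero hi (joinPoly_eltVar h i), map_zero]
  · rintro f ⟨i, j, -, rfl⟩
    rw [SetLike.mem_coe, RingHom.mem_ker, map_sub, AlgHom.comp_apply, AlgHom.comp_apply,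
      hφ.map_joinPoly_linForm h, hφ.map_joinPoly_linForm h, sub_eq_zero]
    exact hφ.map_linForm_eq _ _

/-- The homomorphism out of `A^*(M ／ Z)` induced by a homomorphism that kills the center ideal. -/
noncomputable def KillsCenter.descend [M.Finite] (h : IsMatroidalFlip M Pm Z)
    (hφ : KillsCenter Z φ) : ChowRing (M ／ Z) (properFlats (M ／ Z)) →ₐ[ℤ] A :=
  Ideal.Quotient.liftₐ _ (φ.comp (joinPoly h)) fun _ ha => hφ.chowIdeal_contract_le h ha

theorem KillsCenter.descend_toChow [M.Finite] (h : IsMatroidalFlip M Pm Z) (hφ : KillsCenter Z φ)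
    (f : PolyRing (M ／ Z) (properFlats (M ／ Z))) :
    hφ.descend h (toChow (M ／ Z) (properFlats (M ／ Z)) f) = φ (joinPoly h f) := rfl

/-- Compare the linear forms of some j ∉ Z and of i ∈ Z: the first gives the linear class of M ／ Z,
while in the second every surviving flat contains Z, hence i. -/
theorem KillsCenter.descend_normalClass [M.Finite] (h : IsMatroidalFlip M Pm Z)
    (hφ : KillsCenter Z φ) {i : M.E} (hi : (i : α) ∈ Z) :
    hφ.descend h (normalClass M Z) = φ (eltVar M Pm i) := by
  classical
  have := h.isOrderFilter.finite
  have := h.finite_properFlats_contract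
  let := Fintype.ofFinite Pm
  let := Fintype.ofFinite (properFlats (M ／ Z))
  obtain ⟨j, hj⟩ := h.exists_notMem
  rw [normalClass, map_sub, finsum_eq_sum_of_fintype, map_sum,
    ← toChow_linForm_eq _ _ (h.toContract j hj), descend_toChow, hφ.map_joinPoly_linForm,
    hφ.map_linForm_eq _ i, map_linForm, sub_eq_iff_eq_add,
    h.sum_joinFlat _ fun F hF => by rw [hφ.map_flatVar F hF, ite_self]]
  congr 1
  refine Finset.sum_congr rfl fun G _ => ?_
  rw [if_pos (h.subset_joinFlat G hi), descend_toChow, joinPoly_flatVar]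

theorem KillsCenter.descend_restrictPoly [M.Finite] (h : IsMatroidalFlip M Pm Z)
    (hφ : KillsCenter Z φ) (f : PolyRing M Pm) :
    hφ.descend h (restrictPoly h f) = φ f := by
  refine DFunLike.congr_fun (f := (hφ.descend h).comp (restrictPoly h))
    (polyRing_hom_ext (fun i => ?_) (fun F => ?_)) f
  · rw [AlgHom.comp_apply]
    by_cases hi : (i : α) ∈ Z
    · rw [restrictPoly_eltVar_of_mem h hi, hφ.descend_normalClass h hi]
    · rw [restrictPoly_eltVar_of_notMem h hi, hφ.map_eltVar i hi, map_zero]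
  · rw [AlgHom.comp_apply]
    by_cases hF : Z ⊆ (F : Set α)
    · rw [restrictPoly_flatVar h hF, descend_toChow, joinPoly_flatVar, h.joinFlat_contractFlat]
    · rw [restrictPoly_flatVar_of_not_subset h hF, hφ.map_flatVar F hF, map_zero]

end KillsCenter

/-- The quotient map by the center ideal kills the center, hence factors through the restriction; so
it vanishes wherever the restriction does. -/
theorem mem_centerIdeal_of_restriction_eq_zero [M.Finite] (h : IsMatroidalFlip M Pm Z)
    {a : ChowRing M Pm} (ha : restriction h a = 0) : a ∈ centerIdeal M Pm Z := by
  obtain ⟨f, rfl⟩ := Ideal.Quotient.mk_surjective a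
  have hφ : KillsCenter (A := ChowRing M Pm ⧸ centerIdeal M Pm Z) Z
      ((Ideal.Quotient.mkₐ ℤ (centerIdeal M Pm Z)).comp (toChow M Pm)) := by
    refine ⟨fun f hf => ?_, fun i hi => ?_, fun F hF => ?_⟩
    · rw [AlgHom.comp_apply, toChow_eq_zero_iff.2 hf, map_zero]
    · exact Ideal.Quotient.eq_zero_iff_mem.2 (eltVar_mem_centerIdeal hi)
    · exact Ideal.Quotient.eq_zero_iff_mem.2 (flatVar_mem_centerIdeal hF)
  have h1 := hφ.descend_restrictPoly h f
  rw [← restriction_toChow] at h1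
  exact Ideal.Quotient.eq_zero_iff_mem.1
    (h1.symm.trans ((congrArg (hφ.descend h) ha).trans (map_zero _)))

end Restriction

end MatroidChow

namespace MatroidChow

variable {α : Type*} {M : Matroid α} {Pm : Set (Set α)} {Z : Set α}

/-! ### The class of the center -/

/-- The product of the classes `x_i` for `i` in a basis `I` of `Z` is killed by the center ideal. -/
theorem mul_prod_eltVar_eq_zero (h : IsMatroidalFlip M Pm Z) {I : Finset M.E}
    (hI : M.IsBasis (Subtype.val '' (I : Set M.E)) Z) {a : ChowRing M Pm}
    (ha : a ∈ centerIdeal M Pm Z) : a * ∏ i ∈ I, toChow M Pm (eltVar M Pm i) = 0 := by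
  classical
  have hcl : M.closure (Subtype.val '' (I : Set M.E)) = Z := by
    rw [hI.closure_eq_closure, h.isFlat.closure]
  induction ha using Submodule.span_induction with
  | mem a ha =>
    rcases ha with ⟨i, hi, rfl⟩ | ⟨F, hF, rfl⟩
    · have hiI : i ∉ I := fun hiI => hi (hI.subset ⟨i, hiI, rfl⟩)
      rw [← Finset.prod_insert (f := fun i => toChow M Pm (eltVar M Pm i)) hiI]
      have himg : Subtype.val '' ((insert i I : Finset M.E) : Set M.E) =
          insert (i : α) (Subtype.val '' (I : Set M.E)) := by
        rw [Finset.coe_insert, Set.image_insert_eq]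
      refine prod_eltVar ?_ ?_ <;> rw [himg]
      · exact ((hI.indep.notMem_closure_iff i.2).1 (hcl ▸ hi)).1
      -- The closure of I ∪ {i} strictly contains Z, so by maximality of Z it lies in P₋ unless it
      -- is the whole ground set.
      · set G := M.closure (insert (i : α) (Subtype.val '' (I : Set M.E))) with hG
        have hiG : (i : α) ∈ G := M.mem_closure_of_mem' (Set.mem_insert _ _) i.2
        by_cases hGE : G = M.E
        · exact Or.inr hGE
        · refine Or.inl (h.mem_of_ssubset ⟨M.isFlat_closure _, ⟨i, hiG⟩, hGE⟩
            ⟨?_, fun hs => hi (hs hiG)⟩)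
          rw [← hcl]
          exact M.closure_subset_closure (Set.subset_insert _ _)
    -- A flat containing the basis I would contain Z, so some x_i with i ∈ I annihilates x_F.
    · obtain ⟨i, hi, hiF⟩ : ∃ i ∈ I, (i : α) ∉ (F : Set α) := by
        by_contra! hcon
        refine hF ?_
        rw [← hcl, ← (h.isOrderFilter.subset_properFlats F.2).1.closure]
        refine M.closure_subset_closure ?_
        rintro _ ⟨i, hi, rfl⟩
        exact hcon i hi
      rw [← Finset.mul_prod_erase I _ hi, ← mul_assoc, mul_comm (toChow M Pm (flatVar M Pm F)),
        eltVar_mul_flatVar hiF, zero_mul]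
  | zero => exact zero_mul _
  | add a b _ _ iha ihb => rw [add_mul, iha, ihb, add_zero]
  | smul a b _ ihb => rw [smul_eq_mul, mul_assoc, ihb, mul_zero]

open Classical in
-- Multiply the linear relation between e and y by ∏_{i ∈ J} x_i. A flat missing an element of J
-- contributes zero; a flat containing J contains e if and only if it contains y, since either one
-- spans Z together with J. Only the terms x_e and x_y are left.
theorem prod_insert_eltVar_eq [M.Finite] (h : IsMatroidalFlip M Pm Z) {J : Finset M.E}
    {e y : M.E} (he : e ∉ J) (hy : y ∉ J)
    (hIe : M.IsBasis (Subtype.val '' (insert e J : Set M.E)) Z)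
    (hIy : M.IsBasis (Subtype.val '' (insert y J : Set M.E)) Z) :
    ∏ i ∈ insert e J, toChow M Pm (eltVar M Pm i) =
      ∏ i ∈ insert y J, toChow M Pm (eltVar M Pm i) := by
  have := h.isOrderFilter.finite
  let := Fintype.ofFinite Pm
  have key : ∀ {a b : M.E}, M.IsBasis (Subtype.val '' (insert a J : Set M.E)) Z → (b : α) ∈ Z →
      ∀ {F : Pm}, (∀ i ∈ J, (i : α) ∈ (F : Set α)) → (a : α) ∈ (F : Set α) →
      (b : α) ∈ (F : Set α) := by
    intro a b hIa hb F hJF ha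
    have hFf := (h.isOrderFilter.subset_properFlats F.2).1
    rw [← hFf.closure]
    refine M.closure_subset_closure ?_ (hIa.subset_closure hb)
    rintro _ ⟨i, rfl | hi, rfl⟩
    exacts [ha, hJF i hi]
  have heZ : (e : α) ∈ Z := hIe.subset ⟨e, Set.mem_insert _ _, rfl⟩
  have hyZ : (y : α) ∈ Z := hIy.subset ⟨y, Set.mem_insert _ _, rfl⟩
  rw [Finset.prod_insert he, Finset.prod_insert hy]
  have hlin := congrArg (· * ∏ i ∈ J, toChow M Pm (eltVar M Pm i)) (toChow_linForm M Pm e y)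
  simp only [map_linForm, add_mul, Finset.sum_mul] at hlin
  have hsum : ∀ F : Pm,
      (if (e : α) ∈ (F : Set α) then toChow M Pm (flatVar M Pm F) else 0) *
        ∏ i ∈ J, toChow M Pm (eltVar M Pm i) =
      (if (y : α) ∈ (F : Set α) then toChow M Pm (flatVar M Pm F) else 0) *
        ∏ i ∈ J, toChow M Pm (eltVar M Pm i) := by
    intro F
    by_cases hJF : ∀ i ∈ J, (i : α) ∈ (F : Set α)
    · rw [show ((e : α) ∈ (F : Set α)) ↔ ((y : α) ∈ (F : Set α)) from
        ⟨key hIe hyZ hJF, key hIy heZ hJF⟩]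
    · push Not at hJF
      obtain ⟨i, hi, hiF⟩ := hJF
      have h0 : toChow M Pm (flatVar M Pm F) * ∏ i ∈ J, toChow M Pm (eltVar M Pm i) = 0 := by
        rw [← Finset.mul_prod_erase J _ hi, ← mul_assoc,
          mul_comm (toChow M Pm (flatVar M Pm F)), eltVar_mul_flatVar hiF, zero_mul]
      simp only [ite_mul, zero_mul, h0, ite_self]
  rw [Finset.sum_congr rfl fun F _ => hsum F] at hlin
  exact add_right_cancel hlin

/-- The product of the classes `x_i` for `i` in a basis of `Z` does not depend on the basis. -/
theorem prod_eltVar_basis_eq [M.Finite] (h : IsMatroidalFlip M Pm Z) {I I' : Finset M.E}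
    (hI : M.IsBasis (Subtype.val '' (I : Set M.E)) Z)
    (hI' : M.IsBasis (Subtype.val '' (I' : Set M.E)) Z) :
    ∏ i ∈ I, toChow M Pm (eltVar M Pm i) = ∏ i ∈ I', toChow M Pm (eltVar M Pm i) := by
  classical
  -- Each basis exchange in the restriction of M to Z replaces an element of I \ I' by one of I',
  -- which lowers this cardinality.
  induction hn : (I \ I').card using Nat.strong_induction_on generalizing I with
  | _ n ih =>
  rcases (I \ I').eq_empty_or_nonempty with hemp | ⟨e, he⟩
  · rw [Finset.sdiff_eq_empty_iff_subset] at hemp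
    have := hI.eq_of_subset_indep hI'.indep (Set.image_mono (Finset.coe_subset.2 hemp)) hI'.subset
    rw [Finset.coe_injective (Subtype.val_injective.image_injective this)]
  · obtain ⟨heI, heI'⟩ := Finset.mem_sdiff.1 he
    have hZ : Z ⊆ M.E := h.isFlat.subset_ground
    have hmem : ∀ {i : M.E} {K : Finset M.E},
        (i : α) ∈ Subtype.val '' (K : Set M.E) ↔ i ∈ K := by simp
    obtain ⟨y, ⟨hyI', hyI⟩, hbase⟩ := hI.isBase_restrict.exchange hI'.isBase_restrict
      (e := (e : α)) ⟨hmem.2 heI, fun hc => heI' (hmem.1 hc)⟩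
    obtain ⟨y, hy, rfl⟩ := hyI'
    have hyI₂ : y ∉ I := fun hc => hyI (hmem.2 hc)
    have hset : insert (y : α) (Subtype.val '' (I : Set M.E) \ {(e : α)}) =
        Subtype.val '' (insert y (I.erase e : Set M.E)) := by
      rw [Set.image_insert_eq, Finset.coe_erase, Set.image_sdiff Subtype.val_injective,
        Set.image_singleton]
    rw [hset, Matroid.isBase_restrict_iff] at hbase
    have hstep := prod_insert_eltVar_eq h (J := I.erase e) (Finset.notMem_erase e I)
      (fun hc => hyI₂ (Finset.mem_of_mem_erase hc)) (by
        rwa [Finset.coe_erase, Set.insert_sdiff_singleton, Set.insert_eq_of_mem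
          (Finset.mem_coe.2 heI)]) hbase
    rw [Finset.insert_erase heI] at hstep
    rw [hstep]
    refine ih _ ?_ (by rwa [Finset.coe_insert]) rfl
    rw [← hn]
    refine Finset.card_lt_card ((Finset.ssubset_iff_of_subset ?_).2 ⟨e, he, ?_⟩)
    · intro i hi
      simp only [Finset.mem_sdiff, Finset.mem_insert, Finset.mem_erase] at hi ⊢
      rcases hi with ⟨rfl | hi, hi'⟩
      · exact absurd hy hi'
      · exact ⟨hi.2, hi'⟩
    · simp only [Finset.mem_sdiff, Finset.mem_insert, Finset.mem_erase]
      rintro ⟨rfl | hi, -⟩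
      · exact hyI₂ heI
      · exact hi.1 rfl

/-! ### The polynomial model of the blow-up -/

open Polynomial

/-- The ideal of `R[X]` generated by `p` and the `a X ^ k` with `ρ a = 0` and `k ≥ 1`. -/
noncomputable def blowIdeal {R T : Type*} [CommRing R] [CommRing T] (ρ : R →+* T) (p : R[X]) :
    Ideal R[X] :=
  (RingHom.ker (mapRingHom ρ) ⊓ RingHom.ker (evalRingHom 0)) ⊔ Ideal.span {p}

/-- The first summand of `blowIdeal` is exactly what the image under ρ and the value at 0 cannot
detect. -/
theorem mem_blowIdeal_of_eq {R T : Type*} [CommRing R] [CommRing T] {ρ : R →+* T} {p f g : R[X]}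
    (hg : g ∈ blowIdeal ρ p) (h1 : f.map ρ = g.map ρ) (h2 : f.eval 0 = g.eval 0) :
    f ∈ blowIdeal ρ p := by
  rw [← sub_add_cancel f g]
  refine add_mem (Ideal.mem_sup_left ⟨?_, ?_⟩) hg
  · rw [SetLike.mem_coe, RingHom.mem_ker, map_sub, coe_mapRingHom, h1, sub_self]
  · rw [SetLike.mem_coe, RingHom.mem_ker, map_sub, coe_evalRingHom, h2, sub_self]

/-- Uniqueness of remainders. If f = g + k p with g in the first summand, then ρ(f) is a multiple of
the monic (X - β)^d of degree less than d, so it vanishes, and with it ρ(k). The constant term of k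
then lies in ker ρ, which annihilates p(0), so f(0) = 0 as well. -/
theorem map_eq_zero_of_mem_blowIdeal {R T : Type*} [CommRing R] [CommRing T] {ρ : R →+* T}
    {p f : R[X]} {β : T} {d : ℕ} (hp : p.map ρ = (C β - X) ^ d)
    (hc : ∀ a, ρ a = 0 → a * p.eval 0 = 0) (hf : f ∈ blowIdeal ρ p)
    (hd : (f.map ρ).degree < d) : f.map ρ = 0 ∧ f.eval 0 = 0 := by
  obtain ⟨g, ⟨hg1, hg2⟩, k', hk', rfl⟩ := Submodule.mem_sup.1 hf
  obtain ⟨k, rfl⟩ := Ideal.mem_span_singleton'.1 hk'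
  rw [SetLike.mem_coe, RingHom.mem_ker, coe_mapRingHom] at hg1
  rw [SetLike.mem_coe, RingHom.mem_ker, coe_evalRingHom] at hg2
  have hmon : ((X - C β) ^ d).Monic := (monic_X_sub_C β).pow d
  have hp' : p.map ρ = (X - C β) ^ d * (-1) ^ d := by
    rw [hp, ← mul_pow]
    congr 1
    ring
  have hmap : (g + k * p).map ρ = (X - C β) ^ d * ((-1) ^ d * k.map ρ) := by
    rw [Polynomial.map_add, hg1, zero_add, Polynomial.map_mul, hp']
    ring
  -- A nonzero image makes T nontrivial, which is needed for (X - β)^d to have degree exactly d.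
  have h0 : (g + k * p).map ρ = 0 := by
    by_contra hne
    have : Nontrivial T := by
      by_contra hT
      rw [not_nontrivial_iff_subsingleton] at hT
      exact hne (Subsingleton.elim _ _)
    refine hmon.not_dvd_of_degree_lt hne ?_ ⟨_, hmap⟩
    rwa [degree_eq_natDegree hmon.ne_zero, (monic_X_sub_C β).natDegree_pow, natDegree_X_sub_C,
      mul_one]
  refine ⟨h0, ?_⟩
  rw [h0] at hmap
  have hk : k.map ρ = 0 := by
    have h1 := (hmon.mul_right_eq_zero_iff).1 hmap.symm
    have h2 := congrArg ((-1) ^ d * ·) h1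
    simpa [← mul_assoc, ← mul_pow] using h2
  rw [eval_add, hg2, zero_add, eval_mul]
  refine hc _ ?_
  rw [← coeff_zero_eq_eval_zero, ← coeff_map, hk, coeff_zero]

end MatroidChow

namespace MatroidChow

variable {α : Type*} {M : Matroid α} {Pm : Set (Set α)} {Z : Set α}

/-! ### The map to the polynomial model, and injectivity -/

open Polynomial

open Classical in
/-- The homomorphism `ℤ[x_i, x_F] → A^*(M, P₋)[X]` with `x_Z ↦ X`, `x_F ↦ x_F` for `F ∈ P₋`,
`x_i ↦ x_i - X` for `i ∈ Z` and `x_i ↦ x_i` for `i ∉ Z`. -/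
noncomputable def blowPoly (M : Matroid α) (Pm : Set (Set α)) (Z : Set α) :
    PolyRing M (Pm ∪ {Z}) →ₐ[ℤ] (ChowRing M Pm)[X] :=
  MvPolynomial.aeval (Sum.elim
    (fun i : M.E => if (i : α) ∈ Z then C (toChow M Pm (eltVar M Pm i)) - X
      else C (toChow M Pm (eltVar M Pm i)))
    (fun F : (Pm ∪ {Z} : Set (Set α)) => if hF : (F : Set α) ∈ Pm then C (toChow M Pm (flatVar M Pm ⟨F, hF⟩))
      else X))

theorem blowPoly_eltVar_of_mem {i : M.E} (hi : (i : α) ∈ Z) :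
    blowPoly M Pm Z (eltVar M (Pm ∪ {Z}) i) = C (toChow M Pm (eltVar M Pm i)) - X := by
  rw [blowPoly, eltVar, MvPolynomial.aeval_X, Sum.elim_inl, if_pos hi]

theorem blowPoly_eltVar_of_notMem {i : M.E} (hi : (i : α) ∉ Z) :
    blowPoly M Pm Z (eltVar M (Pm ∪ {Z}) i) = C (toChow M Pm (eltVar M Pm i)) := by
  rw [blowPoly, eltVar, MvPolynomial.aeval_X, Sum.elim_inl, if_neg hi]

theorem eval_blowPoly_eltVar (i : M.E) :
    (blowPoly M Pm Z (eltVar M (Pm ∪ {Z}) i)).eval 0 = toChow M Pm (eltVar M Pm i) := by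
  by_cases hi : (i : α) ∈ Z
  · rw [blowPoly_eltVar_of_mem hi, eval_sub, eval_C, eval_X, sub_zero]
  · rw [blowPoly_eltVar_of_notMem hi, eval_C]

theorem blowPoly_inclFlat (F : Pm) :
    blowPoly M Pm Z (flatVar M (Pm ∪ {Z}) (inclFlat Pm Z F)) =
      C (toChow M Pm (flatVar M Pm F)) := by
  rw [blowPoly, flatVar, MvPolynomial.aeval_X, Sum.elim_inr,
    dif_pos (show (inclFlat Pm Z F : Set α) ∈ Pm from F.2)]
  rfl

theorem blowPoly_centerFlat (h : IsMatroidalFlip M Pm Z) :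
    blowPoly M Pm Z (flatVar M (Pm ∪ {Z}) (centerFlat Pm Z)) = X := by
  rw [blowPoly, flatVar, MvPolynomial.aeval_X, Sum.elim_inr,
    dif_neg (show (centerFlat Pm Z : Set α) ∉ Pm from h.notMem)]

theorem blowPoly_pullbackPoly (h : IsMatroidalFlip M Pm Z) (f : PolyRing M Pm) :
    blowPoly M Pm Z (pullbackPoly M Pm Z f) = C (toChow M Pm f) := by
  refine DFunLike.congr_fun (f := (blowPoly M Pm Z).comp (pullbackPoly M Pm Z))
    (g := CAlgHom.comp (toChow M Pm)) (polyRing_hom_ext (fun i => ?_) (fun F => ?_)) f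
  · rw [AlgHom.comp_apply, pullbackPoly_eltVar]
    split_ifs with hi
    · rw [map_add, blowPoly_eltVar_of_mem hi, blowPoly_centerFlat h, sub_add_cancel]
      rfl
    · rw [blowPoly_eltVar_of_notMem hi]
      rfl
  · rw [AlgHom.comp_apply, pullbackPoly_flatVar, blowPoly_inclFlat]
    rfl

theorem inclFlat_or_centerFlat (F : (Pm ∪ {Z} : Set (Set α))) :
    (∃ G : Pm, F = inclFlat Pm Z G) ∨ F = centerFlat Pm Z := by
  rcases F with ⟨F, hF | hF⟩
  · exact Or.inl ⟨⟨F, hF⟩, rfl⟩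
  · exact Or.inr (Subtype.ext hF)

/-- The polynomial whose value at `x_Z` is `∏ i ∈ I, x_i`. -/
noncomputable def basisPoly (M : Matroid α) (Pm : Set (Set α)) (I : Finset M.E) :
    (ChowRing M Pm)[X] :=
  ∏ i ∈ I, (C (toChow M Pm (eltVar M Pm i)) - X)

theorem map_basisPoly [M.Finite] (h : IsMatroidalFlip M Pm Z) {I : Finset M.E}
    (hI : M.IsBasis (Subtype.val '' (I : Set M.E)) Z) :
    (basisPoly M Pm I).map (restriction h) =
      (C (normalClass M Z) - X) ^ I.card := by
  rw [basisPoly, Polynomial.map_prod]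
  refine Finset.prod_eq_pow_card fun i hi => ?_
  rw [Polynomial.map_sub, map_C, map_X]
  congr 2
  exact restrictPoly_eltVar_of_mem h (hI.subset ⟨i, hi, rfl⟩)

theorem eval_basisPoly (I : Finset M.E) :
    (basisPoly M Pm I).eval 0 = ∏ i ∈ I, toChow M Pm (eltVar M Pm i) := by
  rw [basisPoly, eval_prod]
  exact Finset.prod_congr rfl fun i _ => by rw [eval_sub, eval_C, eval_X, sub_zero]

theorem card_eq_of_isBasis {I J : Finset M.E}
    (hI : M.IsBasis (Subtype.val '' (I : Set M.E)) Z)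
    (hJ : M.IsBasis (Subtype.val '' (J : Set M.E)) Z) : I.card = J.card := by
  have h1 := hI.encard_eq_eRk.trans hJ.encard_eq_eRk.symm
  rwa [Subtype.val_injective.encard_image, Subtype.val_injective.encard_image,
    Set.encard_coe_eq_coe_finsetCard, Set.encard_coe_eq_coe_finsetCard, Nat.cast_inj] at h1

theorem C_mul_X_mem_blowIdeal {R T : Type*} [CommRing R] [CommRing T] {ρ : R →+* T} {p : R[X]}
    {a : R} (ha : ρ a = 0) : C a * X ∈ blowIdeal ρ p :=
  mem_blowIdeal_of_eq (zero_mem _) (by simp [ha]) (by simp)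

/-- Relations involving x_Z become multiples a X with ρ(a) = 0. The polynomial b is needed only for
the closure relations of bases of Z, which are not relations for P₋. -/
theorem chowIdeal_le_comap_blowPoly [M.Finite] (h : IsMatroidalFlip M Pm Z) {B : Finset M.E}
    (hB : M.IsBasis (Subtype.val '' (B : Set M.E)) Z) :
    chowIdeal M (Pm ∪ {Z}) ≤ (blowIdeal (restriction h)
      (basisPoly M Pm B)).comap (blowPoly M Pm Z) := by
  have hρF : ∀ F : Pm, ¬ Z ⊆ (F : Set α) →
      restriction h (toChow M Pm (flatVar M Pm F)) = 0 :=
    fun F hF => restrictPoly_flatVar_of_not_subset h hF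
  have hρi : ∀ i : M.E, (i : α) ∉ Z →
      restriction h (toChow M Pm (eltVar M Pm i)) = 0 :=
    fun i hi => restrictPoly_eltVar_of_notMem h hi
  refine chowIdeal_le ?_ ?_ ?_ ?_
  · rintro f ⟨F, G, hFG, hGF, rfl⟩
    rw [SetLike.mem_coe, Ideal.mem_comap, map_mul]
    obtain ⟨F, rfl⟩ | rfl := inclFlat_or_centerFlat F <;>
      obtain ⟨G, rfl⟩ | rfl := inclFlat_or_centerFlat G
    · rw [blowPoly_inclFlat, blowPoly_inclFlat, ← C_mul,
        flatVar_mul_flatVar (F := F) (G := G) hFG hGF, C_0]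
      exact zero_mem _
    · rw [blowPoly_inclFlat, blowPoly_centerFlat h]
      exact C_mul_X_mem_blowIdeal (hρF F hGF)
    · rw [blowPoly_inclFlat, blowPoly_centerFlat h, X_mul_C]
      exact C_mul_X_mem_blowIdeal (hρF G hFG)
    · exact absurd subset_rfl hFG
  · rintro f ⟨i, F, hiF, rfl⟩
    rw [SetLike.mem_coe, Ideal.mem_comap, map_mul]
    obtain ⟨F, rfl⟩ | rfl := inclFlat_or_centerFlat F
    · rw [blowPoly_inclFlat]
      have h0 := eltVar_mul_flatVar (F := F) hiF
      by_cases hi : (i : α) ∈ Z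
      · rw [blowPoly_eltVar_of_mem hi, sub_mul, ← C_mul, h0, C_0, zero_sub, X_mul_C]
        exact neg_mem (C_mul_X_mem_blowIdeal (hρF F fun hs => hiF (hs hi)))
      · rw [blowPoly_eltVar_of_notMem hi, ← C_mul, h0, C_0]
        exact zero_mem _
    · rw [blowPoly_centerFlat h, blowPoly_eltVar_of_notMem (Z := Z) hiF]
      exact C_mul_X_mem_blowIdeal (hρi i hiF)
  · rintro f ⟨I, hI, hcl, rfl⟩
    rw [SetLike.mem_coe, Ideal.mem_comap, map_prod]
    have heval : (∏ i ∈ I, blowPoly M Pm Z (eltVar M (Pm ∪ {Z}) i)).eval 0 =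
        ∏ i ∈ I, toChow M Pm (eltVar M Pm i) := by
      rw [eval_prod]
      exact Finset.prod_congr rfl fun i _ => eval_blowPoly_eltVar i
    by_cases hZ : M.closure (Subtype.val '' (I : Set M.E)) = Z
    · have hIZ : M.IsBasis (Subtype.val '' (I : Set M.E)) Z := hZ ▸ hI.isBasis_closure
      have hprod : ∏ i ∈ I, blowPoly M Pm Z (eltVar M (Pm ∪ {Z}) i) = basisPoly M Pm I :=
        Finset.prod_congr rfl fun i hi => blowPoly_eltVar_of_mem (hIZ.subset ⟨i, hi, rfl⟩)
      rw [hprod]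
      -- The polynomials of I and B may differ, but only by an element of the first summand: both
      -- restrict to the same power of β - X, and both take the same value at 0 because the product
      -- over a basis is independent of the basis.
      refine mem_blowIdeal_of_eq (Ideal.mem_sup_right (Ideal.mem_span_singleton_self _)) ?_ ?_
      · rw [map_basisPoly h hIZ, map_basisPoly h hB, card_eq_of_isBasis hIZ hB]
      · rw [eval_basisPoly, eval_basisPoly, prod_eltVar_basis_eq h hIZ hB]
    · have hcl' : M.closure (Subtype.val '' (I : Set M.E)) ∈ Pm ∪ {M.E} := by
        rcases hcl with (hcl | hcl) | hcl
        exacts [Or.inl hcl, absurd hcl hZ, Or.inr hcl]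
      obtain ⟨i, hi, hiZ⟩ := exists_mem_notMem_center h hcl'
      refine mem_blowIdeal_of_eq (zero_mem _) ?_ ?_
      · rw [Polynomial.map_prod, Polynomial.map_zero, Finset.prod_eq_zero hi]
        rw [blowPoly_eltVar_of_notMem hiZ, map_C, hρi i hiZ, C_0]
      · rw [heval, prod_eltVar hI hcl', eval_zero]
  · rintro f ⟨i, j, -, rfl⟩
    rw [SetLike.mem_coe, Ideal.mem_comap, map_sub, ← pullbackPoly_linForm h,
      ← pullbackPoly_linForm h, blowPoly_pullbackPoly h, blowPoly_pullbackPoly h,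
      toChow_linForm M Pm i j, sub_self]
    exact zero_mem _

/-- The pullback and the Gysin homomorphisms with `p < rk Z` are jointly injective. -/
theorem eq_zero_of_pullback_add_sum_gysin_eq_zero [M.Finite] (h : IsMatroidalFlip M Pm Z)
    {B : Finset M.E} (hB : M.IsBasis (Subtype.val '' (B : Set M.E)) Z)
    {r : ChowRing M Pm} {s : Finset ℕ} (hs1 : ∀ p ∈ s, 1 ≤ p) (hsB : ∀ p ∈ s, p < B.card)
    (hB0 : 0 < B.card) (f : ℕ → PolyRing (M ／ Z) (properFlats (M ／ Z)))
    (h0 : pullback h r + ∑ p ∈ s, centerClass M Pm Z ^ p *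
      toChow M (Pm ∪ {Z}) (gysinPoly h (f p)) = 0) :
    r = 0 ∧ ∀ p ∈ s, toChow (M ／ Z) (properFlats (M ／ Z)) (f p) = 0 := by
  obtain ⟨r, rfl⟩ := Ideal.Quotient.mk_surjective r
  set R := ChowRing M Pm
  -- The remainder attached to the given relation, with the classes of T lifted to R along the
  -- polynomial section.
  let g : R[X] := C (toChow M Pm r) + ∑ p ∈ s, C (toChow M Pm (joinPoly h (f p))) * X ^ p
  have hcoeff : ∀ n, g.coeff n = (if n = 0 then toChow M Pm r else 0) +
      if n ∈ s then toChow M Pm (joinPoly h (f n)) else 0 := by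
    intro n
    simp only [g, coeff_add, coeff_C, finsetSum_coeff, coeff_C_mul, coeff_X_pow, mul_ite, mul_one,
      mul_zero, Finset.sum_ite_eq]
  have hg : g ∈ blowIdeal (restriction h) (basisPoly M Pm B) := by
    have hpoly : toChow M (Pm ∪ {Z}) (pullbackPoly M Pm Z r +
        ∑ p ∈ s, flatVar M (Pm ∪ {Z}) (centerFlat Pm Z) ^ p * gysinPoly h (f p)) = 0 := by
      rw [map_add, map_sum]
      simp only [map_mul, map_pow]
      exact h0
    have hmem := chowIdeal_le_comap_blowPoly h hB (toChow_eq_zero_iff.1 hpoly)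
    rw [Ideal.mem_comap, map_add, map_sum, blowPoly_pullbackPoly h] at hmem
    convert hmem using 2
    refine Finset.sum_congr rfl fun p _ => ?_
    rw [map_mul, map_pow, blowPoly_centerFlat h, ← pullbackPoly_joinPoly, blowPoly_pullbackPoly h,
      X_pow_mul_C]
  have hdeg : (g.map (restriction h)).degree < B.card := by
    refine degree_map_le.trans_lt ((degree_lt_iff_coeff_zero _ _).2 fun n hn => ?_)
    rw [hcoeff, if_neg (show ¬ n = 0 by omega), if_neg fun hns => absurd (hsB n hns) (by omega), add_zero]
  obtain ⟨hmap, heval⟩ := map_eq_zero_of_mem_blowIdeal (map_basisPoly h hB) (fun a ha => by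
    rw [eval_basisPoly]
    exact mul_prod_eltVar_eq_zero h hB (mem_centerIdeal_of_restriction_eq_zero h ha)) hg hdeg
  refine ⟨?_, fun p hp => ?_⟩
  · rw [← coeff_zero_eq_eval_zero, hcoeff, if_pos rfl,
      if_neg fun hc => absurd (hs1 0 hc) (by omega), add_zero] at heval
    exact heval
  · have hc := congrArg (coeff · p) hmap
    have hp1 := hs1 p hp
    rw [coeff_map, hcoeff, if_neg (show ¬ p = 0 by omega), if_pos hp, zero_add, coeff_zero] at hc
    rw [← restrictPoly_joinPoly h]
    exact hc

end MatroidChow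

namespace MatroidChow

variable {α : Type*} {M : Matroid α} {Pm : Set (Set α)} {Z : Set α}

/-! ### Graded pieces -/

section Graded

variable {P : Set (Set α)}

/-- A homomorphism maps homogeneous polynomials of degree `n` into `N n` if multiplication by the
images of the variables raises the index of `N` by one. -/
theorem map_mem_of_isHomogeneous {σ A : Type*} [CommRing A] [Algebra ℤ A]
    (φ : MvPolynomial σ ℤ →ₐ[ℤ] A) (N : ℕ → AddSubgroup A) (h1 : 1 ∈ N 0)
    (hX : ∀ v n, ∀ x ∈ N n, φ (MvPolynomial.X v) * x ∈ N (n + 1))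
    {f : MvPolynomial σ ℤ} {n : ℕ} (hf : f.IsHomogeneous n) : φ f ∈ N n := by
  have key : ∀ (m : σ →₀ ℕ) (k : ℕ), ∀ x ∈ N k,
      φ (MvPolynomial.monomial m 1) * x ∈ N (k + m.degree) := by
    intro m
    induction m using Finsupp.induction_linear with
    | zero => intro k x hx; simpa using hx
    | add a b iha ihb =>
      intro k x hx
      rw [← one_mul (1 : ℤ), ← MvPolynomial.monomial_mul, map_mul, mul_assoc, map_add,
        add_comm a.degree, ← add_assoc]
      exact iha _ _ (ihb _ _ hx)
    | single i b =>
      intro k x hx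
      rw [← MvPolynomial.X_pow_eq_monomial, Finsupp.degree_single, map_pow]
      induction b with
      | zero => simpa using hx
      | succ b ih =>
        rw [pow_succ', mul_assoc, ← add_assoc]
        exact hX _ _ _ ih
  rw [f.as_sum, map_sum]
  refine sum_mem fun m hm => ?_
  have hdeg : m.degree = n := by
    rw [Finsupp.degree_eq_weight_one]
    exact hf (MvPolynomial.mem_support_iff.1 hm)
  have hmon : φ (MvPolynomial.monomial m (f.coeff m)) =
      f.coeff m • φ (MvPolynomial.monomial m (1 : ℤ)) := by
    rw [← mul_one (f.coeff m), ← MvPolynomial.C_mul_monomial, map_mul, eq_intCast, map_intCast,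
      mul_one, zsmul_eq_mul]
  rw [hmon, ← hdeg]
  refine zsmul_mem ?_ _
  simpa using key m 0 1 h1

theorem mem_chowDeg_natCast {n : ℕ} {x : ChowRing M P} :
    x ∈ chowDeg M P n ↔ ∃ f : PolyRing M P, f.IsHomogeneous n ∧ toChow M P f = x := by
  rw [chowDeg, if_pos (Int.natCast_nonneg n), Int.toNat_natCast]
  rfl

theorem mul_mem_chowDeg {i j : ℤ} {a b : ChowRing M P} (ha : a ∈ chowDeg M P i)
    (hb : b ∈ chowDeg M P j) : a * b ∈ chowDeg M P (i + j) := by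
  by_cases hi : 0 ≤ i
  · by_cases hj : 0 ≤ j
    · lift i to ℕ using hi
      lift j to ℕ using hj
      obtain ⟨f, hf, rfl⟩ := mem_chowDeg_natCast.1 ha
      obtain ⟨g, hg, rfl⟩ := mem_chowDeg_natCast.1 hb
      rw [← Nat.cast_add]
      exact mem_chowDeg_natCast.2 ⟨f * g, hf.mul hg, map_mul _ _ _⟩
    · rw [chowDeg, if_neg hj, Submodule.mem_bot] at hb
      rw [hb, mul_zero]
      exact zero_mem _
  · rw [chowDeg, if_neg hi, Submodule.mem_bot] at ha
    rw [ha, zero_mul]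
    exact zero_mem _

theorem one_mem_chowDeg : (1 : ChowRing M P) ∈ chowDeg M P 0 :=
  mem_chowDeg_natCast.2 ⟨1, MvPolynomial.isHomogeneous_one _ _, map_one _⟩

theorem eltVar_mem_chowDeg (i : M.E) : toChow M P (eltVar M P i) ∈ chowDeg M P 1 :=
  mem_chowDeg_natCast.2 ⟨_, MvPolynomial.isHomogeneous_X _ _, rfl⟩

theorem flatVar_mem_chowDeg (F : P) : toChow M P (flatVar M P F) ∈ chowDeg M P 1 :=
  mem_chowDeg_natCast.2 ⟨_, MvPolynomial.isHomogeneous_X _ _, rfl⟩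

theorem linClass_mem_chowDeg [Finite P] : linClass M P ∈ chowDeg M P 1 := by
  classical
  let := Fintype.ofFinite P
  by_cases hE : Nonempty M.E
  · rw [← toChow_linForm_eq M P hE.some, map_linForm]
    refine add_mem (eltVar_mem_chowDeg _) (sum_mem fun F _ => ?_)
    split_ifs
    exacts [flatVar_mem_chowDeg F, zero_mem _]
  · rw [linClass, dif_neg hE]
    exact zero_mem _

end Graded

theorem normalClass_mem_chowDeg [M.Finite] (h : IsMatroidalFlip M Pm Z) :
    normalClass M Z ∈ chowDeg (M ／ Z) (properFlats (M ／ Z)) 1 := by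
  have := h.finite_properFlats_contract
  let := Fintype.ofFinite (properFlats (M ／ Z))
  rw [normalClass, finsum_eq_sum_of_fintype]
  exact sub_mem linClass_mem_chowDeg (sum_mem fun F _ => flatVar_mem_chowDeg F)

theorem restriction_mem_chowDeg [M.Finite] (h : IsMatroidalFlip M Pm Z) {q : ℤ}
    {r : ChowRing M Pm} (hr : r ∈ chowDeg M Pm q) :
    restriction h r ∈ chowDeg (M ／ Z) (properFlats (M ／ Z)) q := by
  by_cases hq : 0 ≤ q
  · lift q to ℕ using hq
    obtain ⟨f, hf, rfl⟩ := mem_chowDeg_natCast.1 hr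
    rw [restriction_toChow]
    refine map_mem_of_isHomogeneous (restrictPoly h)
      (fun n => (chowDeg (M ／ Z) (properFlats (M ／ Z)) n).toAddSubgroup) one_mem_chowDeg
      (fun v n x hx => ?_) hf
    rw [Nat.cast_add, add_comm]
    refine mul_mem_chowDeg ?_ hx
    rcases v with i | F
    · by_cases hi : (i : α) ∈ Z
      · exact (restrictPoly_eltVar_of_mem h hi).symm ▸ normalClass_mem_chowDeg h
      · exact (restrictPoly_eltVar_of_notMem h hi).symm ▸ zero_mem _
    · by_cases hF : Z ⊆ (F : Set α)
      · exact (restrictPoly_flatVar h hF).symm ▸ flatVar_mem_chowDeg _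
      · exact (restrictPoly_flatVar_of_not_subset h hF).symm ▸ zero_mem _
  · rw [chowDeg, if_neg hq, Submodule.mem_bot] at hr
    rw [hr, map_zero]
    exact zero_mem _

/-! ### The Gysin homomorphisms and the restriction -/

/-- On generators these are the complement relations x_i x_Z = 0 and the incomparability relations
x_F x_Z = 0, since no F in P₋ lies inside Z. -/
theorem centerClass_mul_pullback_eq_zero [M.Finite] (h : IsMatroidalFlip M Pm Z)
    {a : ChowRing M Pm} (ha : a ∈ centerIdeal M Pm Z) :
    centerClass M Pm Z * pullback h a = 0 := by
  induction ha using Submodule.span_induction with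
  | mem a ha =>
    rcases ha with ⟨i, hi, rfl⟩ | ⟨F, hF, rfl⟩
    · rw [pullback_toChow, pullbackPoly_eltVar, if_neg hi, mul_comm]
      exact eltVar_mul_flatVar (F := centerFlat Pm Z) hi
    · rw [pullback_toChow, pullbackPoly_flatVar]
      exact flatVar_mul_flatVar (F := centerFlat Pm Z) hF (h.not_subset F.2)
  | zero => rw [map_zero, mul_zero]
  | add a b _ _ iha ihb => rw [map_add, mul_add, iha, ihb, add_zero]
  | smul a b _ ihb => rw [smul_eq_mul, map_mul, mul_left_comm, ihb, mul_zero]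

/-- Projection formula: r and the lift of its restriction differ by an element of the center ideal,
which x_Z annihilates after pullback. -/
theorem gysin_restriction [M.Finite] (h : IsMatroidalFlip M Pm Z) (p : ℕ) (hp : 1 ≤ p)
    (r : ChowRing M Pm) :
    gysin h p hp (restriction h r) = centerClass M Pm Z ^ p * pullback h r := by
  obtain ⟨g, hg⟩ := Ideal.Quotient.mk_surjective (restriction h r)
  have hg' : toChow (M ／ Z) (properFlats (M ／ Z)) g = restriction h r := hg
  have hker : r - toChow M Pm (joinPoly h g) ∈ centerIdeal M Pm Z := by
    refine mem_centerIdeal_of_restriction_eq_zero h ?_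
    rw [map_sub, restriction_toChow, restrictPoly_joinPoly, hg', sub_self]
  have h0 := centerClass_mul_pullback_eq_zero h hker
  rw [map_sub, mul_sub, sub_eq_zero] at h0
  obtain ⟨n, rfl⟩ := Nat.exists_eq_add_of_le' hp
  rw [← hg', gysin_toChow, ← pullbackPoly_joinPoly, ← pullback_toChow, pow_succ, mul_assoc,
    mul_assoc, h0]

/-! ### Surjectivity -/

/-- The span of the `x_Z ^ p * Φ r` with `p < k` and `r` of degree `q - p`. -/
noncomputable def powerSpan [M.Finite] (h : IsMatroidalFlip M Pm Z) (k : ℕ) (q : ℤ) :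
    Submodule ℤ (ChowRing M (Pm ∪ {Z})) :=
  Submodule.span ℤ {s | ∃ p < k, ∃ r ∈ chowDeg M Pm (q - p),
    s = centerClass M Pm Z ^ p * pullback h r}

section PowerSpan

variable [M.Finite] (h : IsMatroidalFlip M Pm Z)

theorem pow_mul_mem_powerSpan {k p : ℕ} (hp : p < k) {q : ℤ} {r : ChowRing M Pm}
    (hr : r ∈ chowDeg M Pm (q - p)) :
    centerClass M Pm Z ^ p * pullback h r ∈ powerSpan h k q :=
  Submodule.subset_span ⟨p, hp, r, hr, rfl⟩

theorem powerSpan_mono {k k' : ℕ} (hk : k ≤ k') (q : ℤ) : powerSpan h k q ≤ powerSpan h k' q := by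
  refine Submodule.span_mono ?_
  rintro _ ⟨p, hp, r, hr, rfl⟩
  exact ⟨p, hp.trans_le hk, r, hr, rfl⟩

theorem pullback_mul_mem_powerSpan {k : ℕ} {q : ℤ} {a : ChowRing M Pm} (ha : a ∈ chowDeg M Pm 1)
    {x : ChowRing M (Pm ∪ {Z})} (hx : x ∈ powerSpan h k q) :
    pullback h a * x ∈ powerSpan h k (q + 1) := by
  induction hx using Submodule.span_induction with
  | mem x hx =>
    obtain ⟨p, hp, r, hr, rfl⟩ := hx
    rw [mul_left_comm, ← map_mul]
    refine pow_mul_mem_powerSpan h hp ?_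
    rw [show q + 1 - (p : ℤ) = 1 + (q - p) by ring]
    exact mul_mem_chowDeg ha hr
  | zero => rw [mul_zero]; exact zero_mem _
  | add a b _ _ iha ihb => rw [mul_add]; exact add_mem iha ihb
  | smul c x _ ih => rw [mul_smul_comm]; exact Submodule.smul_mem _ _ ih

theorem centerClass_mul_mem_powerSpan_succ {k : ℕ} {q : ℤ} {x : ChowRing M (Pm ∪ {Z})}
    (hx : x ∈ powerSpan h k q) : centerClass M Pm Z * x ∈ powerSpan h (k + 1) (q + 1) := by
  induction hx using Submodule.span_induction with
  | mem x hx =>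
    obtain ⟨p, hp, r, hr, rfl⟩ := hx
    rw [← mul_assoc, ← pow_succ']
    refine pow_mul_mem_powerSpan h (Nat.succ_lt_succ hp) ?_
    rwa [show q + 1 - ((p + 1 : ℕ) : ℤ) = q - p by push_cast; ring]
  | zero => rw [mul_zero]; exact zero_mem _
  | add a b _ _ iha ihb => rw [mul_add]; exact add_mem iha ihb
  | smul c x _ ih => rw [mul_smul_comm]; exact Submodule.smul_mem _ _ ih

/-- With u = x_Z, expanding the product in powers of u leaves only lower powers besides the leading
term (-u)^|I|. -/
theorem prod_sub_mem_powerSpan (I : Finset M.E) {q : ℤ} {r : ChowRing M Pm}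
    (hr : r ∈ chowDeg M Pm q) :
    (∏ i ∈ I, (pullback h (toChow M Pm (eltVar M Pm i)) - centerClass M Pm Z)) * pullback h r -
      (-1) ^ I.card * (centerClass M Pm Z ^ I.card * pullback h r) ∈
      powerSpan h I.card (q + I.card) := by
  classical
  induction I using Finset.induction_on with
  | empty => simp
  | insert e I he ih =>
    rw [Finset.prod_insert he, Finset.card_insert_of_notMem he]
    set k := I.card
    set u := centerClass M Pm Z
    set a := pullback h (toChow M Pm (eltVar M Pm e))
    set l := (∏ i ∈ I, (pullback h (toChow M Pm (eltVar M Pm i)) - u)) * pullback h r -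
      (-1) ^ k * (u ^ k * pullback h r) with hl
    have hprod : (∏ i ∈ I, (pullback h (toChow M Pm (eltVar M Pm i)) - u)) * pullback h r =
      l + (-1) ^ k * (u ^ k * pullback h r) := by rw [hl, sub_add_cancel]
    have hexp : (a - u) * (∏ i ∈ I, (pullback h (toChow M Pm (eltVar M Pm i)) - u)) *
        pullback h r - (-1) ^ (k + 1) * (u ^ (k + 1) * pullback h r) =
        a * l - u * l + (-1) ^ k * (a * (u ^ k * pullback h r)) := by
      rw [mul_assoc, hprod]
      ring
    rw [hexp, Nat.cast_add, Nat.cast_one, ← add_assoc]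
    have hsign : ∀ {x : ChowRing M (Pm ∪ {Z})} {N : Submodule ℤ (ChowRing M (Pm ∪ {Z}))},
        x ∈ N → (-1) ^ k * x ∈ N := by
      intro x N hx
      rcases neg_one_pow_eq_or (ChowRing M (Pm ∪ {Z})) k with hk | hk <;> rw [hk]
      · rwa [one_mul]
      · rw [neg_one_mul]
        exact neg_mem hx
    refine add_mem (sub_mem ?_ ?_) (hsign ?_)
    · exact powerSpan_mono h k.le_succ _ (pullback_mul_mem_powerSpan h (eltVar_mem_chowDeg e) ih)
    · exact centerClass_mul_mem_powerSpan_succ h ih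
    · refine pullback_mul_mem_powerSpan h (eltVar_mem_chowDeg e)
        (pow_mul_mem_powerSpan h k.lt_succ_self ?_)
      rwa [add_sub_cancel_right]

theorem pow_card_mul_mem_powerSpan {B : Finset M.E}
    (hB : M.IsBasis (Subtype.val '' (B : Set M.E)) Z) {q : ℤ} {r : ChowRing M Pm} (hr : r ∈ chowDeg M Pm q) :
    centerClass M Pm Z ^ B.card * pullback h r ∈ powerSpan h B.card (q + B.card) := by
  -- For i ∈ Z the factor is x_i in A^*(M, P₊), so this is the closure relation of B, whose closure
  -- Z belongs to P₊.
  have h0 : ∏ i ∈ B, (pullback h (toChow M Pm (eltVar M Pm i)) - centerClass M Pm Z) = 0 := by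
    rw [← prod_eltVar (M := M) (P := Pm ∪ {Z}) hB.indep (Or.inl (Or.inr (by
      rw [hB.closure_eq_closure, h.isFlat.closure]; rfl)))]
    refine Finset.prod_congr rfl fun i hi => ?_
    rw [pullback_toChow, pullbackPoly_eltVar, if_pos (hB.subset ⟨i, hi, rfl⟩), map_add,
      centerClass, add_sub_cancel_right]
  have hmem := prod_sub_mem_powerSpan h B hr
  rw [h0, zero_mul, zero_sub] at hmem
  have hmem' := neg_mem_iff.1 hmem
  rcases neg_one_pow_eq_or (ChowRing M (Pm ∪ {Z})) B.card with hk | hk <;> rw [hk] at hmem'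
  · rwa [one_mul] at hmem'
  · rw [neg_one_mul] at hmem'
    exact neg_mem_iff.1 hmem'

theorem centerClass_mul_mem_powerSpan {B : Finset M.E}
    (hB : M.IsBasis (Subtype.val '' (B : Set M.E)) Z) {q : ℤ} {x : ChowRing M (Pm ∪ {Z})}
    (hx : x ∈ powerSpan h B.card q) :
    centerClass M Pm Z * x ∈ powerSpan h B.card (q + 1) := by
  induction hx using Submodule.span_induction with
  | mem x hx =>
    obtain ⟨p, hp, r, hr, rfl⟩ := hx
    rw [← mul_assoc, ← pow_succ']
    rcases (Nat.succ_le_of_lt hp).lt_or_eq with hp' | hp'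
    · refine pow_mul_mem_powerSpan h hp' ?_
      rwa [show q + 1 - ((p + 1 : ℕ) : ℤ) = q - p by push_cast; ring]
    · have := pow_card_mul_mem_powerSpan h hB hr
      rw [← hp'] at this ⊢
      rwa [show q - p + ((p + 1 : ℕ) : ℤ) = q + 1 by push_cast; ring] at this
  | zero => rw [mul_zero]; exact zero_mem _
  | add a b _ _ iha ihb => rw [mul_add]; exact add_mem iha ihb
  | smul c x _ ih => rw [mul_smul_comm]; exact Submodule.smul_mem _ _ ih

/-- The span contains 1, since the rank of Z is positive, and is stable under multiplication by
every variable; for i ∈ Z one uses x_i = Φ(x_i) - x_Z. -/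
theorem chowDeg_le_powerSpan {B : Finset M.E}
    (hB : M.IsBasis (Subtype.val '' (B : Set M.E)) Z) (hB0 : 0 < B.card) (q : ℕ) :
    chowDeg M (Pm ∪ {Z}) q ≤ powerSpan h B.card q := by
  intro x hx
  obtain ⟨f, hf, rfl⟩ := mem_chowDeg_natCast.1 hx
  refine map_mem_of_isHomogeneous (toChow M (Pm ∪ {Z})) (fun n => (powerSpan h B.card n).toAddSubgroup) ?_
    (fun v n x hx => ?_) hf
  · have h1 := pow_mul_mem_powerSpan h (q := 0) (r := 1) hB0 one_mem_chowDeg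
    rwa [pow_zero, one_mul, map_one] at h1
  · rw [Nat.cast_add, Nat.cast_one]
    rcases v with i | F
    · have he := pullback_mul_mem_powerSpan h (eltVar_mem_chowDeg i) hx
      rw [pullback_toChow, pullbackPoly_eltVar] at he
      split_ifs at he with hi
      · rw [map_add, add_mul] at he
        exact (add_mem_cancel_right (centerClass_mul_mem_powerSpan h hB hx)).1 he
      · exact he
    · obtain ⟨G, rfl⟩ | rfl := inclFlat_or_centerFlat F
      · have he := pullback_mul_mem_powerSpan h (flatVar_mem_chowDeg G) hx
        rwa [pullback_toChow, pullbackPoly_flatVar] at he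
      · exact centerClass_mul_mem_powerSpan h hB hx

end PowerSpan

/-! ### Bijectivity of the decomposition map -/

theorem decompositionMap_apply [M.Finite] (h : IsMatroidalFlip M Pm Z) (q : ℤ)
    [Fintype {p : ℕ // 1 ≤ p ∧ (p : ℕ∞) < M.eRk Z}] (r : chowDeg M Pm q)
    (y : ⨁ p : {p : ℕ // 1 ≤ p ∧ (p : ℕ∞) < M.eRk Z},
        chowDeg (M ／ Z) (properFlats (M ／ Z)) (q - (p : ℕ))) :
    (decompositionMap h q (r, y) : ChowRing M (Pm ∪ {Z})) =
      pullback h r + ∑ p : {p : ℕ // 1 ≤ p ∧ (p : ℕ∞) < M.eRk Z},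
        gysin h p p.2.1 (y p : ChowRing (M ／ Z) (properFlats (M ／ Z))) := by
  classical
  conv_lhs => rw [← DirectSum.sum_univ_of y]
  rw [decompositionMap, LinearMap.coprod_apply, map_sum, Submodule.coe_add, Submodule.coe_sum]
  congr 1
  refine Finset.sum_congr rfl fun p _ => ?_
  rw [← DirectSum.lof_eq_of ℤ, DirectSum.toModule_lof]
  rfl

theorem decompositionMap_bijective [M.Finite] [M.Loopless] (h : IsMatroidalFlip M Pm Z) (q : ℕ) :
    Function.Bijective (decompositionMap h (q : ℤ)) := by
  classical
  obtain ⟨J, hJ⟩ := M.exists_isBasis Z h.isFlat.subset_ground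
  have hfin : (Subtype.val ⁻¹' J : Set M.E).Finite :=
    (M.ground_finite.subset hJ.indep.subset_ground).preimage Subtype.val_injective.injOn
  obtain ⟨B, hBJ⟩ : ∃ B : Finset M.E, Subtype.val '' (B : Set M.E) = J := by
    refine ⟨hfin.toFinset, ?_⟩
    rw [hfin.coe_toFinset, Subtype.image_preimage_coe, Set.inter_eq_right]
    exact hJ.indep.subset_ground
  have hB : M.IsBasis (Subtype.val '' (B : Set M.E)) Z := hBJ ▸ hJ
  have hcard : (B.card : ℕ∞) = M.eRk Z := by
    rw [← hB.encard_eq_eRk, Subtype.val_injective.encard_image, Set.encard_coe_eq_coe_finsetCard]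
  -- An empty basis would make Z the set of loops, which is empty, whereas Z is nonempty.
  have hB0 : 0 < B.card := by
    rw [Finset.card_pos, Finset.nonempty_iff_ne_empty]
    rintro rfl
    have hcl := hB.closure_eq_closure
    rw [Finset.coe_empty, Set.image_empty, h.isFlat.closure,
      show M.closure ∅ = ∅ from M.loops_eq_empty] at hcl
    exact h.maximal.prop.1.2.1.ne_empty hcl.symm
  have hmem : ∀ p : ℕ, p ∈ Finset.Ioo 0 B.card ↔ 1 ≤ p ∧ (p : ℕ∞) < M.eRk Z := by
    intro p
    rw [Finset.mem_Ioo, ← hcard, Nat.cast_lt]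
    rfl
  let := Fintype.subtype _ hmem
  constructor
  · rw [← LinearMap.ker_eq_bot, LinearMap.ker_eq_bot']
    rintro ⟨r, y⟩ hry
    have h0 := congrArg Subtype.val hry
    rw [decompositionMap_apply] at h0
    choose f hf using fun p : {p : ℕ // 1 ≤ p ∧ (p : ℕ∞) < M.eRk Z} =>
      Ideal.Quotient.mk_surjective (y p : ChowRing (M ／ Z) (properFlats (M ／ Z)))
    -- The lifts are extended by zero outside the range 1 ≤ p < rk Z; only values inside it are
    -- used.
    let f' : ℕ → PolyRing (M ／ Z) (properFlats (M ／ Z)) := fun p =>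
      if hp : 1 ≤ p ∧ (p : ℕ∞) < M.eRk Z then f ⟨p, hp⟩ else 0
    have hf' : ∀ p : {p : ℕ // 1 ≤ p ∧ (p : ℕ∞) < M.eRk Z},
        toChow (M ／ Z) (properFlats (M ／ Z)) (f' p) = y p := by
      intro p
      simp only [f', dif_pos p.2]
      exact hf p
    have hsum : ∑ p ∈ Finset.Ioo 0 B.card, centerClass M Pm Z ^ p *
        toChow M (Pm ∪ {Z}) (gysinPoly h (f' p)) =
        ∑ p : {p : ℕ // 1 ≤ p ∧ (p : ℕ∞) < M.eRk Z},
          gysin h p p.2.1 (y p : ChowRing (M ／ Z) (properFlats (M ／ Z))) := by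
      rw [Finset.sum_subtype _ hmem]
      exact Finset.sum_congr rfl fun p _ => by rw [← hf', gysin_toChow]
    rw [← hsum] at h0
    obtain ⟨hr, hy⟩ := eq_zero_of_pullback_add_sum_gysin_eq_zero h hB
      (fun p hp => (Finset.mem_Ioo.1 hp).1) (fun p hp => (Finset.mem_Ioo.1 hp).2) hB0 f' h0
    refine Prod.ext (Subtype.ext hr) (DFinsupp.ext fun p => Subtype.ext ?_)
    exact (hf' p).symm.trans (hy p ((hmem p).2 p.2))
  · rw [← LinearMap.range_eq_top, eq_top_iff]
    rintro ⟨x, hx⟩ -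
    have hle : powerSpan h B.card q ≤
        (LinearMap.range (decompositionMap h (q : ℤ))).map (Submodule.subtype _) := by
      refine Submodule.span_le.2 ?_
      rintro _ ⟨p, hp, r, hr, rfl⟩
      rcases Nat.eq_zero_or_pos p with rfl | hp0
      · refine ⟨_, ⟨(⟨r, by simpa using hr⟩, 0), rfl⟩, ?_⟩
        rw [Submodule.subtype_apply, decompositionMap_apply, Finset.sum_eq_zero, add_zero,
          pow_zero, one_mul]
        exact fun p _ => map_zero _
      -- By the projection formula, x_Z^p Φ(r) is the Gysin image of the restriction of r.
      · have hp' := (hmem p).1 (Finset.mem_Ioo.2 ⟨hp0, hp⟩)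
        refine ⟨_, ⟨(0, DirectSum.lof ℤ _ (fun p : {p : ℕ // 1 ≤ p ∧ (p : ℕ∞) < M.eRk Z} =>
          chowDeg (M ／ Z) (properFlats (M ／ Z)) (q - (p : ℕ))) ⟨p, hp'⟩
          ⟨_, restriction_mem_chowDeg h hr⟩), rfl⟩, ?_⟩
        rw [decompositionMap, LinearMap.coprod_apply, map_zero, zero_add, DirectSum.toModule_lof]
        exact gysin_restriction h p hp0 r
    obtain ⟨y, hy, hyx⟩ := hle (chowDeg_le_powerSpan h hB hB0 q hx)
    rwa [show (⟨x, hx⟩ : chowDeg M (Pm ∪ {Z}) q) = y from Subtype.ext hyx.symm]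

end MatroidChow

theorem mainTheorem5 {α : Type*} (M : Matroid α) [M.Finite] [M.Loopless]
    (Pm : Set (Set α)) (Z : Set α) (h : MatroidChow.IsMatroidalFlip M Pm Z)
    (q : ℕ) (hq : 1 ≤ q) :
    Function.Bijective (MatroidChow.decompositionMap h (q : ℤ)) :=
  MatroidChow.decompositionMap_bijective h q
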